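/- **Arithmetic regularity lemma for $U^3$.** Conventions. Write $\mathbb{E}_{x}$ for the average over a finite set. A *factor* on $\mathbb{F}_5^n$ is the $\sigma$-algebra generated by finitely many functions $\phi_1,\dots,\phi_k:\mathbb{F}_5^n\to\mathbb{F}_5$; its atoms are the non-empty sets $\{x:\phi_1(x)=c_1,\dots,\phi_k(x)=c_k\}$. A factor $\mathcal{B}'$ *refines* $\mathcal{B}$ if every atom of $\mathcal{B}'$ is contained in an atom of $\mathcal{B}$. For $f:\mathbb{F}_5^n\to\mathbb{R}$, $\mathbb{E}(f|\mathcal{B})(x)$ is the average of $f$ over the atom of $\mathcal{B}$ containing $x$. A *quadratic factor of complexity $(d_1,d_2)$* is a pair $(\mathcal{B}_1,\mathcal{B}_2)$ for which there are vectors $r_1,\dots,r_{d_1}\in\mathbb{F}_5^n$ and symmetric $n\times n$ matrices $M_1,\dots,M_{d_2}$ over $\mathbb{F}_5$ such that $\mathcal{B}_1$ is generated by the functions $r_j^Tx$, and $\mathcal{B}_2$ by the functions $r_j^Tx$ and $x^TM_jx$. It has complexity *at most* $(d_1,d_2)$ if it has complexity $(k_1,k_2)$ for some $k_1\le d_1$,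 $k_2\le d_2$. A quadratic factor $(\mathcal{B}_1,\mathcal{B}_2)$ refines another $(\mathcal{B}^{(0)}_1,\mathcal{B}^{(0)}_2)$ if $\mathcal{B}_i$ refines $\mathcal{B}_i^{(0)}$ for $i=1,2$. Finally $\Vert g\Vert_2=(\mathbb{E}_x g(x)^2)^{1/2}$ and \[ \Vert g\Vert_{U^3}^8=\mathbb{E}_{x,h_1,h_2,h_3\in\mathbb{F}_5^n}\ \prod_{S\subseteq\{1,2,3\}} g\Big(x+\sum_{i\in S}h_i\Big),\qquad \Vert g\Vert_{U^3}\ge 0.\] Statement. Let $\delta>0$, let $\omega:[0,\infty)\to(0,\infty)$ be an arbitrary function (a "growth function", which may depend on $\delta$), and let $d^{(0)}_1,d^{(0)}_2\ge 0$ be integers. Then there is a constant $C=C(\delta,\omega,d^{(0)}_1,d^{(0)}_2)$ such that the following holds for every $n\ge 0$, every $f:\mathbb{F}_5^n\to[-1,1]$ and every quadratic factor $(\mathcal{B}^{(0)}_1,\mathcal{B}^{(0)}_2)$ on $\mathbb{F}_5^n$ of complexity $(d^{(0)}_1,d^{(0)}_2)$. There are an integer $0\le d\le C$, a quadratic factor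 $(\mathcal{B}_1,\mathcal{B}_2)$ of complexity at most $(d,d)$ which refines $(\mathcal{B}^{(0)}_1,\mathcal{B}^{(0)}_2)$, and a decomposition $f=f_1+f_2+f_3$ with \[ f_1=\mathbb{E}(f|\mathcal{B}_2),\qquad \Vert f_2\Vert_2\le\delta,\qquad \Vert f_3\Vert_{U^3}\le\frac1{\omega(d)}.\] -/

import Mathlib

open Finset BigOperators

noncomputable section

namespace QuadFourier

/-- The vector space `𝔽₅ⁿ`. -/
abbrev V (n : ℕ) : Type := Fin n → ZMod 5

/-- The factor (σ-algebra) generated by a family of functions `φ i : 𝔽₅ⁿ → 𝔽₅`. -/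
def generatedFactor {n : ℕ} {ι : Type} (φ : ι → V n → ZMod 5) : MeasurableSpace (V n) :=
  ⨆ i, MeasurableSpace.comap (φ i) ⊤

/-- The atom of the factor `B` which contains `x`. -/
def atom {n : ℕ} (B : MeasurableSpace (V n)) (x : V n) : Set (V n) :=
  @measurableAtom (V n) B x

/-- The atoms of a generated factor are the joint level sets of the generating functions. -/
theorem atom_generatedFactor {n : ℕ} {ι : Type} (φ : ι → V n → ZMod 5) (x : V n) :
    atom (generatedFactor φ) x = {y | ∀ i, φ i y = φ i x} := by
  apply Set.Subset.antisymm
  · intro y hy i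
    have h := Set.mem_iInter₂.1 hy (φ i ⁻¹' {φ i x}) rfl
    refine Set.mem_iInter.1 h ?_
    exact MeasurableSpace.le_def.1 (le_iSup (fun i => MeasurableSpace.comap (φ i) ⊤) i) _
      ⟨{φ i x}, trivial, rfl⟩
  · intro y hy
    have hle : generatedFactor φ ≤
        MeasurableSpace.comap (fun (z : V n) (i : ι) => φ i z) ⊤ := by
      refine iSup_le fun i => ?_
      rintro _ ⟨s, -, rfl⟩
      exact ⟨{g | g i ∈ s}, trivial, rfl⟩
    refine Set.mem_iInter₂.2 fun s hx => Set.mem_iInter.2 fun hs => ?_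
    obtain ⟨t, -, rfl⟩ := hle s hs
    have heq : (fun i => φ i y) = fun i => φ i x := funext hy
    change (fun i => φ i y) ∈ t
    rw [heq]
    exact hx

/-- `B'` refines `B`: every atom of `B'` is contained in an atom of `B`. -/
def Refines {n : ℕ} (B' B : MeasurableSpace (V n)) : Prop :=
  ∀ x, ∃ y, atom B' x ⊆ atom B y

open Classical in
/-- The conditional expectation `𝔼(f | B)`: its value at `x` is the average of `f` over the
atom of `B` which contains `x`. -/
def condExpect {n : ℕ} (f : V n → ℝ) (B : MeasurableSpace (V n)) (x : V n) : ℝ :=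
  𝔼 y ∈ univ.filter (fun y => y ∈ atom B x), f y

/-- `(B₁, B₂)` is a (homogeneous) quadratic factor of complexity `(d₁, d₂)`: for some vectors
`r₁, …, r_{d₁}` and symmetric matrices `M₁, …, M_{d₂}`, the σ-algebra `B₁` is generated by the
linear forms `rⱼᵀ x`, and `B₂` by these together with the quadratic forms `xᵀ Mⱼ x`. -/
def IsQuadraticFactor {n : ℕ} (B₁ B₂ : MeasurableSpace (V n)) (d₁ d₂ : ℕ) : Prop :=
  ∃ (r : Fin d₁ → V n) (M : Fin d₂ → Matrix (Fin n) (Fin n) (ZMod 5)),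
    (∀ j, (M j).IsSymm) ∧
    B₁ = generatedFactor (fun j x => r j ⬝ᵥ x) ∧
    B₂ = generatedFactor
      (Sum.elim (fun j x => r j ⬝ᵥ x) (fun j x => x ⬝ᵥ (M j).mulVec x))

/-- `(B₁, B₂)` is a quadratic factor of complexity at most `(d₁, d₂)`. -/
def IsQuadraticFactorAtMost {n : ℕ} (B₁ B₂ : MeasurableSpace (V n)) (d₁ d₂ : ℕ) : Prop :=
  ∃ k₁ ≤ d₁, ∃ k₂ ≤ d₂, IsQuadraticFactor B₁ B₂ k₁ k₂

/-- The `L²` norm with respect to the uniform probability measure on `𝔽₅ⁿ`. -/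
def l2Norm {n : ℕ} (f : V n → ℝ) : ℝ := Real.sqrt (𝔼 x, f x ^ 2)

/-- The Gowers `U³` norm. -/
def u3Norm {n : ℕ} (f : V n → ℝ) : ℝ :=
  (𝔼 x, 𝔼 h₁, 𝔼 h₂, 𝔼 h₃,
    f x * f (x + h₁) * f (x + h₂) * f (x + h₃) *
      f (x + h₁ + h₂) * f (x + h₁ + h₃) * f (x + h₂ + h₃) *
      f (x + h₁ + h₂ + h₃)) ^ (1 / 8 : ℝ)

end QuadFourier

end

noncomputable section

namespace QuadFourier

/-! ### Conditional expectations -/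

/-! The theorem is an energy increment driven by the inverse theorem for U³. If f − E(f|B₂) has U³
norm at least ε, it correlates with a quadratic phase, and adjoining that phase to the factor raises
the energy E_x E(f|B₂)(x)² by a constant depending only on ε (`energy_increment`). Energy is at most
1, so boundedly many steps reach any prescribed uniformity (`exists_refinement_u3Norm_le`). In
`arithmetic_regularity` this is nested: a factor B of complexity K is refined to D with ‖f −
E(f|D)‖_{U³} ≤ 1/ω(K), and f₁ = E(f|B), f₂ = E(f|D) − E(f|B), f₃ = f − E(f|D). If ‖f₂‖₂ > δ the
energy grows by more than δ², which can happen at most 1/δ² times. The complexity of D does not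
enter the bound on f₃, since ω is evaluated at that of B.

The inverse theorem rests on the ambiguity function A(h,ξ), the squared Fourier coefficient at ξ of
x ↦ f(x)f(x+h). Its second moment gives the U³ norm (`u3Pow_eq`), and it is its own symplectic
Fourier transform (`amb_self_dual`), hence positive definite. So the set where A is large has many
differences at which A is still large, and Balog–Szemerédi–Gowers with Freiman places much of it in
a coset of a subgroup of size O(5ⁿ). Positive definiteness also says that no coset of a subgroup
carries more mass than the subgroup itself (`sum_coset_le`); this moves the mass to the subgroup,
then to the graph of a linear map, then to the graph of a symmetric matrix M. Twisting f by the
phase of 3M, where 3 = 1/2 in 𝔽₅, turns this mass into a large U² norm, hence a large Fourier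
coefficient. -/

theorem self_mem_atom {n : ℕ} (B : MeasurableSpace (V n)) (x : V n) : x ∈ atom B x :=
  @mem_measurableAtom_self (V n) B x

theorem mem_atom_comm {n : ℕ} {B : MeasurableSpace (V n)} {x y : V n} (h : y ∈ atom B x) :
    x ∈ atom B y := by
  refine Set.mem_iInter₂.2 fun s hy => Set.mem_iInter.2 fun hs => ?_
  by_contra hx
  exact @mem_of_mem_measurableAtom (V n) B x y h sᶜ hs.compl hx hy

theorem mem_atom_trans {n : ℕ} {B : MeasurableSpace (V n)} {x y z : V n} (h : y ∈ atom B x)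
    (h' : z ∈ atom B y) : z ∈ atom B x := by
  refine Set.mem_iInter₂.2 fun s hx => Set.mem_iInter.2 fun hs => ?_
  exact @mem_of_mem_measurableAtom (V n) B y z h' s hs
    (@mem_of_mem_measurableAtom (V n) B x y h s hs hx)

theorem atom_eq_of_mem {n : ℕ} {B : MeasurableSpace (V n)} {x y : V n} (h : y ∈ atom B x) :
    atom B y = atom B x :=
  Set.Subset.antisymm (fun _ hz => mem_atom_trans h hz)
    (fun _ hz => mem_atom_trans (mem_atom_comm h) hz)

theorem Refines.atom_subset {n : ℕ} {B' B : MeasurableSpace (V n)} (h : Refines B' B) (x : V n) :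
    atom B' x ⊆ atom B x := by
  obtain ⟨y, hy⟩ := h x
  rwa [atom_eq_of_mem (hy (self_mem_atom B' x))]

theorem Refines.refl {n : ℕ} (B : MeasurableSpace (V n)) : Refines B B :=
  fun x => ⟨x, subset_rfl⟩

theorem Refines.trans {n : ℕ} {A B C : MeasurableSpace (V n)} (h : Refines A B)
    (h' : Refines B C) : Refines A C :=
  fun x => ⟨x, (h.atom_subset x).trans (h'.atom_subset x)⟩

/-- `h` is constant on every atom of `B`. -/
def ConstOnAtoms {n : ℕ} {β : Type*} (B : MeasurableSpace (V n)) (h : V n → β) : Prop :=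
  ∀ x y, y ∈ atom B x → h y = h x

theorem ConstOnAtoms.mono {n : ℕ} {β : Type*} {B' B : MeasurableSpace (V n)} {h : V n → β}
    (hh : ConstOnAtoms B h) (hB : Refines B' B) : ConstOnAtoms B' h :=
  fun x y hy => hh x y (hB.atom_subset x hy)

theorem constOnAtoms_condExpect {n : ℕ} (f : V n → ℝ) (B : MeasurableSpace (V n)) :
    ConstOnAtoms B (condExpect f B) := by
  intro x y hy
  unfold condExpect
  rw [atom_eq_of_mem hy]

open Classical in
theorem condExpect_eq {n : ℕ} (f : V n → ℝ) (B : MeasurableSpace (V n)) (x : V n) :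
    condExpect f B x = ∑ y with y ∈ atom B x, f y / (#{y | y ∈ atom B x} : ℝ) := by
  rw [condExpect, expect_eq_sum_div_card, sum_div]

/-- Conditional expectation is self-adjoint and fixes h, because lying in the same atom is a
symmetric relation. The real case serves Pythagoras, the complex case the quadratic phases. -/
theorem sum_condExpect_mul {n : ℕ} {𝕜 : Type*} [RCLike 𝕜] (f : V n → ℝ)
    {B : MeasurableSpace (V n)} {h : V n → 𝕜} (hh : ConstOnAtoms B h) :
    ∑ x, (condExpect f B x : 𝕜) * h x = ∑ x, (f x : 𝕜) * h x := by
  classical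
  have key : ∀ x, (condExpect f B x : 𝕜) * h x =
      ∑ y, if y ∈ atom B x then (f y : 𝕜) * h y / (#{z | z ∈ atom B y} : 𝕜) else 0 := by
    intro x
    rw [condExpect_eq, ← sum_filter, RCLike.ofReal_sum, sum_mul]
    refine sum_congr rfl fun y hy => ?_
    have hy' : y ∈ atom B x := by simpa using hy
    rw [atom_eq_of_mem hy', hh x y hy']
    push_cast
    ring
  simp_rw [key]
  rw [sum_comm]
  refine sum_congr rfl fun y _ => ?_
  have : ∀ x, y ∈ atom B x ↔ x ∈ atom B y := fun x => ⟨mem_atom_comm, mem_atom_comm⟩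
  simp_rw [this]
  rw [← sum_filter, sum_const, nsmul_eq_mul]
  have hpos : (#{z | z ∈ atom B y} : 𝕜) ≠ 0 := by
    rw [Nat.cast_ne_zero]
    exact card_ne_zero.2 ⟨y, by simpa using self_mem_atom B y⟩
  field_simp

theorem abs_condExpect_le {n : ℕ} {f : V n → ℝ} (hf : ∀ x, |f x| ≤ 1)
    (B : MeasurableSpace (V n)) (x : V n) : |condExpect f B x| ≤ 1 := by
  classical
  rw [condExpect, expect_eq_sum_div_card, abs_div, Nat.abs_cast]
  refine div_le_one_of_le₀ ?_ (Nat.cast_nonneg _)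
  refine (abs_sum_le_sum_abs _ _).trans ((sum_le_sum fun y _ => hf y).trans ?_)
  simp

/-- The energy of `f` with respect to the factor `B`. -/
def energy {n : ℕ} (f : V n → ℝ) (B : MeasurableSpace (V n)) : ℝ :=
  𝔼 x, condExpect f B x ^ 2

theorem energy_nonneg {n : ℕ} (f : V n → ℝ) (B : MeasurableSpace (V n)) : 0 ≤ energy f B :=
  expect_nonneg fun _ _ => sq_nonneg _

theorem energy_le_one {n : ℕ} {f : V n → ℝ} (hf : ∀ x, |f x| ≤ 1) (B : MeasurableSpace (V n)) :
    energy f B ≤ 1 := by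
  refine expect_le univ_nonempty fun x _ => ?_
  rw [← sq_abs]
  exact pow_le_one₀ (abs_nonneg _) (abs_condExpect_le hf B x)

/-- Pythagoras: the cross term and the square of E(f|B) both reduce to the pairing of f with E(f|B).
-/
theorem expect_condExpect_sub_sq {n : ℕ} (f : V n → ℝ) {B' B : MeasurableSpace (V n)}
    (h : Refines B' B) :
    𝔼 x, (condExpect f B' x - condExpect f B x) ^ 2 = energy f B' - energy f B := by
  have hc := constOnAtoms_condExpect f B
  have h1 := sum_condExpect_mul f hc
  have h2 := sum_condExpect_mul f (hc.mono h)
  simp only [RCLike.ofReal_real_eq_id, id] at h1 h2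
  have h3 : ∑ x, (condExpect f B' x - condExpect f B x) ^ 2 =
      ∑ x, condExpect f B' x ^ 2 - ∑ x, condExpect f B x ^ 2 := by
    have : ∀ x, (condExpect f B' x - condExpect f B x) ^ 2 = condExpect f B' x ^ 2
        - 2 * (condExpect f B' x * condExpect f B x) + condExpect f B x * condExpect f B x := by
      intro x; ring
    simp_rw [this, sum_add_distrib, sum_sub_distrib, ← mul_sum, h2, h1, sq]
    linarith
  simp only [energy, Fintype.expect_eq_sum_div_card]
  rw [h3, sub_div]

/-! ### Refining quadratic factors -/

theorem refines_generatedFactor {n : ℕ} {ι κ : Type} {φ : ι → V n → ZMod 5}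
    {ψ : κ → V n → ZMod 5} (h : ∀ k, ∃ i, ψ k = φ i) :
    Refines (generatedFactor φ) (generatedFactor ψ) := by
  refine fun x => ⟨x, ?_⟩
  rw [atom_generatedFactor, atom_generatedFactor]
  intro y hy k
  obtain ⟨i, hi⟩ := h k
  rw [hi]
  exact hy i

theorem IsQuadraticFactor.exists_adjoin {n : ℕ} {B₁ B₂ : MeasurableSpace (V n)} {k₁ k₂ : ℕ}
    (hB : IsQuadraticFactor B₁ B₂ k₁ k₂) {M : Matrix (Fin n) (Fin n) (ZMod 5)} (hM : M.IsSymm)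
    (r : V n) :
    ∃ B₁' B₂' : MeasurableSpace (V n), IsQuadraticFactor B₁' B₂' (k₁ + 1) (k₂ + 1) ∧
      Refines B₁' B₁ ∧ Refines B₂' B₂ ∧
      ConstOnAtoms B₂' (fun x => x ⬝ᵥ M.mulVec x + r ⬝ᵥ x) := by
  obtain ⟨s, Q, hQ, rfl, rfl⟩ := hB
  refine ⟨_, _, ⟨Fin.snoc (α := fun _ => V n) s r,
    Fin.snoc (α := fun _ => Matrix (Fin n) (Fin n) (ZMod 5)) Q M, ?_, rfl, rfl⟩, ?_, ?_, ?_⟩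
  · intro j
    refine Fin.lastCases ?_ (fun j => ?_) j
    · simpa using hM
    · simpa using hQ j
  · exact refines_generatedFactor fun j => ⟨j.castSucc, by simp⟩
  · refine refines_generatedFactor fun j => ?_
    rcases j with j | j
    · exact ⟨Sum.inl j.castSucc, by simp⟩
    · exact ⟨Sum.inr j.castSucc, by simp⟩
  · intro x y hy
    rw [atom_generatedFactor] at hy
    have h1 := hy (Sum.inl (Fin.last _))
    have h2 := hy (Sum.inr (Fin.last _))
    simp only [Sum.elim_inl, Sum.elim_inr, Fin.snoc_last] at h1 h2
    simp only [h1, h2]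

theorem IsQuadraticFactorAtMost.mono {n : ℕ} {B₁ B₂ : MeasurableSpace (V n)} {k₁ k₂ l₁ l₂ : ℕ}
    (h : IsQuadraticFactorAtMost B₁ B₂ k₁ k₂) (h₁ : k₁ ≤ l₁) (h₂ : k₂ ≤ l₂) :
    IsQuadraticFactorAtMost B₁ B₂ l₁ l₂ := by
  obtain ⟨a, ha, b, hb, h⟩ := h
  exact ⟨a, ha.trans h₁, b, hb.trans h₂, h⟩

/-- The quadratic phase `e(xᵀ M x + rᵀ x)`. -/
def quadPhase {n : ℕ} (M : Matrix (Fin n) (Fin n) (ZMod 5)) (r x : V n) : ℂ :=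
  ZMod.stdAddChar (x ⬝ᵥ M.mulVec x + r ⬝ᵥ x)

theorem norm_quadPhase {n : ℕ} (M : Matrix (Fin n) (Fin n) (ZMod 5)) (r x : V n) :
    ‖quadPhase M r x‖ = 1 :=
  AddChar.norm_apply _ _

/-- The inverse theorem for the `U³` norm, as a property. -/
def InverseU3 : Prop := ∀ ε : ℝ, 0 < ε → ∃ η : ℝ, 0 < η ∧ ∀ (n : ℕ) (g : V n → ℝ),
  (∀ x, |g x| ≤ 2) → ε ≤ u3Norm g → ∃ (M : Matrix (Fin n) (Fin n) (ZMod 5)) (r : V n),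
    M.IsSymm ∧ η * Fintype.card (V n) ≤ ‖∑ x, (g x : ℂ) * quadPhase M r x‖

/-- The new phase is constant on atoms of B₂', so f may be replaced by E(f|B₂') in its correlation
with the phase. By Cauchy–Schwarz the L² distance between the two conditional expectations is then
at least η, and its square is the energy gain. -/
theorem energy_increment (hinv : InverseU3) {ε : ℝ} (hε : 0 < ε) :
    ∃ c : ℝ, 0 < c ∧ ∀ (n : ℕ) (f : V n → ℝ), (∀ x, |f x| ≤ 1) →
      ∀ (B₁ B₂ : MeasurableSpace (V n)) (k : ℕ), IsQuadraticFactorAtMost B₁ B₂ k k →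
      ε ≤ u3Norm (f - condExpect f B₂) →
      ∃ B₁' B₂' : MeasurableSpace (V n), IsQuadraticFactorAtMost B₁' B₂' (k + 1) (k + 1) ∧
        Refines B₁' B₁ ∧ Refines B₂' B₂ ∧ energy f B₂ + c ≤ energy f B₂' := by
  obtain ⟨η, hη, H⟩ := hinv ε hε
  refine ⟨η ^ 2, by positivity, fun n f hf B₁ B₂ k ⟨k₁, hk₁, k₂, hk₂, hB⟩ hu => ?_⟩
  -- The bound 2 in `InverseU3` accommodates a difference of two functions with values in [−1,1].
  obtain ⟨M, r, hM, hcor⟩ := H n _ (fun x => by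
    have h1 := hf x
    have h2 := abs_condExpect_le hf B₂ x
    rw [abs_le] at h1 h2 ⊢
    simp only [Pi.sub_apply]
    constructor <;> linarith) hu
  obtain ⟨B₁', B₂', hB', hr₁, hr₂, hc⟩ := hB.exists_adjoin hM r
  refine ⟨B₁', B₂', ⟨_, Nat.succ_le_succ hk₁, _, Nat.succ_le_succ hk₂, hB'⟩, hr₁, hr₂, ?_⟩
  have hphase : ConstOnAtoms B₂' (quadPhase M r) := fun x y hy => by
    have := hc x y hy
    simp only [quadPhase] at this ⊢
    rw [this]
  have hN : (0 : ℝ) < Fintype.card (V n) := by exact_mod_cast Fintype.card_pos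
  have h1 := sum_condExpect_mul f hphase
  have h2 : ∑ x, ((f - condExpect f B₂) x : ℂ) * quadPhase M r x =
      ∑ x, ((condExpect f B₂' x - condExpect f B₂ x : ℝ) : ℂ) * quadPhase M r x := by
    simp only [Pi.sub_apply, Complex.ofReal_sub, sub_mul, sum_sub_distrib]
    congr 1
    exact h1.symm
  have h3 : η * Fintype.card (V n) ≤ ∑ x, |condExpect f B₂' x - condExpect f B₂ x| := by
    refine hcor.trans ?_
    rw [h2]
    refine (norm_sum_le _ _).trans (le_of_eq (sum_congr rfl fun x _ => ?_))
    rw [norm_mul, norm_quadPhase, mul_one, Complex.norm_real, Real.norm_eq_abs]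
  have h5 : (η * Fintype.card (V n)) ^ 2 ≤
      Fintype.card (V n) * ∑ x, (condExpect f B₂' x - condExpect f B₂ x) ^ 2 := by
    refine (pow_le_pow_left₀ (by positivity) h3 2).trans ?_
    have := sq_sum_le_card_mul_sum_sq (s := (univ : Finset (V n)))
      (f := fun x => |condExpect f B₂' x - condExpect f B₂ x|)
    simpa only [sq_abs, card_univ] using this
  have h6 := expect_condExpect_sub_sq f hr₂
  rw [Fintype.expect_eq_sum_div_card, div_eq_iff hN.ne'] at h6
  rw [h6] at h5
  have h7 : η ^ 2 * (Fintype.card (V n) : ℝ) ^ 2 ≤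
      (energy f B₂' - energy f B₂) * (Fintype.card (V n) : ℝ) ^ 2 := by nlinarith
  have := le_of_mul_le_mul_right h7 (by positivity)
  linarith

theorem exists_refinement_u3Norm_le (hinv : InverseU3) {ε : ℝ} (hε : 0 < ε) :
    ∃ m : ℕ, ∀ (n : ℕ) (f : V n → ℝ), (∀ x, |f x| ≤ 1) →
      ∀ (B₁ B₂ : MeasurableSpace (V n)) (k : ℕ), IsQuadraticFactorAtMost B₁ B₂ k k →
      ∃ B₁' B₂' : MeasurableSpace (V n), IsQuadraticFactorAtMost B₁' B₂' (k + m) (k + m) ∧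
        Refines B₁' B₁ ∧ Refines B₂' B₂ ∧ u3Norm (f - condExpect f B₂') ≤ ε := by
  obtain ⟨c, hc, H⟩ := energy_increment hinv hε
  obtain ⟨m, hm⟩ := exists_nat_gt (1 / c)
  refine ⟨m, fun n f hf B₁ B₂ k hB => ?_⟩
  by_contra! hcon
  have step : ∀ j ≤ m, ∃ B₁' B₂' : MeasurableSpace (V n),
      IsQuadraticFactorAtMost B₁' B₂' (k + j) (k + j) ∧
        Refines B₁' B₁ ∧ Refines B₂' B₂ ∧ j * c ≤ energy f B₂' := by
    intro j
    induction j with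
    | zero => exact fun _ => ⟨B₁, B₂, hB, Refines.refl _, Refines.refl _, by
        simpa using energy_nonneg f B₂⟩
    | succ j ih =>
      intro hj
      obtain ⟨C₁, C₂, hC, h1, h2, he⟩ := ih (by omega)
      obtain ⟨D₁, D₂, hD, h1', h2', he'⟩ := H n f hf C₁ C₂ _ hC
        (hcon C₁ C₂ (hC.mono (by omega) (by omega)) h1 h2).le
      refine ⟨D₁, D₂, hD, h1'.trans h1, h2'.trans h2, ?_⟩
      push_cast
      linarith
  obtain ⟨C₁, C₂, -, -, -, he⟩ := step m le_rfl
  have := energy_le_one hf C₂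
  rw [div_lt_iff₀ hc] at hm
  linarith

theorem arithmetic_regularity (hinv : InverseU3) (δ : ℝ) (hδ : 0 < δ) (ω : ℝ → ℝ)
    (hω : ∀ t, 0 ≤ t → 0 < ω t) (d₁ d₂ : ℕ) :
    ∃ C : ℕ, ∀ (n : ℕ) (f : V n → ℝ), (∀ x, f x ∈ Set.Icc (-1 : ℝ) 1) →
      ∀ A₁ A₂ : MeasurableSpace (V n), IsQuadraticFactor A₁ A₂ d₁ d₂ →
        ∃ d ≤ C, ∃ B₁ B₂ : MeasurableSpace (V n),
          IsQuadraticFactorAtMost B₁ B₂ d d ∧ Refines B₁ A₁ ∧ Refines B₂ A₂ ∧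
          ∃ f₁ f₂ f₃ : V n → ℝ, f = f₁ + f₂ + f₃ ∧ f₁ = condExpect f B₂ ∧
            l2Norm f₂ ≤ δ ∧ u3Norm f₃ ≤ 1 / ω d := by
  have hm := fun k : ℕ => exists_refinement_u3Norm_le hinv
    (ε := 1 / ω k) (one_div_pos.2 (hω k (Nat.cast_nonneg k)))
  choose m hm using hm
  -- Complexity after i rounds. It starts at the maximum because one number d bounds both entries of
  -- the complexity.
  let K : ℕ → ℕ := fun i => Nat.rec (max d₁ d₂) (fun _ k => k + m k) i
  have hK : ∀ i, K (i + 1) = K i + m (K i) := fun i => rfl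
  have hKmono : Monotone K := monotone_nat_of_le_succ fun i => by rw [hK]; omega
  obtain ⟨T, hT⟩ := exists_nat_gt (1 / δ ^ 2)
  refine ⟨K T, fun n f hf A₁ A₂ hA => ?_⟩
  replace hf : ∀ x, |f x| ≤ 1 := fun x => abs_le.2 (hf x)
  by_contra! hcon
  have step : ∀ i ≤ T, ∃ B₁ B₂ : MeasurableSpace (V n),
      IsQuadraticFactorAtMost B₁ B₂ (K i) (K i) ∧
        Refines B₁ A₁ ∧ Refines B₂ A₂ ∧ i * δ ^ 2 ≤ energy f B₂ := by
    intro i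
    induction i with
    | zero => exact fun _ => ⟨A₁, A₂, ⟨_, le_max_left _ _, _, le_max_right _ _, hA⟩,
        Refines.refl _, Refines.refl _, by simpa using energy_nonneg f A₂⟩
    | succ i ih =>
      intro hi
      obtain ⟨B₁, B₂, hB, h1, h2, he⟩ := ih (by omega)
      obtain ⟨D₁, D₂, hD, h1', h2', hu⟩ := hm (K i) n f hf B₁ B₂ _ hB
      refine ⟨D₁, D₂, hD, h1'.trans h1, h2'.trans h2, ?_⟩
      by_contra hlt
      -- If the energy gain were below δ², then f₂ would satisfy its L² bound and the coarse factor
      -- B, with d = K i, would give the decomposition.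
      refine absurd hu (hcon (K i) (hKmono (by omega)) B₁ B₂ hB h1 h2 (condExpect f B₂)
        (condExpect f D₂ - condExpect f B₂) (f - condExpect f D₂) (by abel) rfl ?_).not_ge
      refine Real.sqrt_le_iff.2 ⟨hδ.le, ?_⟩
      simp only [Pi.sub_apply]
      rw [expect_condExpect_sub_sq f h2']
      push_cast at hlt
      linarith
  obtain ⟨B₁, B₂, -, -, -, he⟩ := step T le_rfl
  have := energy_le_one hf B₂
  rw [div_lt_iff₀ (by positivity)] at hT
  linarith

/-! ### Fourier analysis on `𝔽₅ⁿ` -/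

/-- The number of elements of `𝔽₅ⁿ`, as a real number. -/
def cardV (n : ℕ) : ℝ := Fintype.card (V n)

theorem cardV_pos (n : ℕ) : 0 < cardV n := by
  unfold cardV
  exact_mod_cast Fintype.card_pos

theorem cardV_ne_zero (n : ℕ) : (cardV n : ℂ) ≠ 0 := by
  exact_mod_cast (cardV_pos n).ne'

/-- The standard additive character of `𝔽₅`. -/
abbrev ec : AddChar (ZMod 5) ℂ := ZMod.stdAddChar

theorem conj_ec (a : ZMod 5) : (starRingEnd ℂ) (ec a) = ec (-a) :=
  (AddChar.map_neg_eq_conj _ _).symm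

theorem norm_ec (a : ZMod 5) : ‖ec a‖ = 1 := AddChar.norm_apply _ _

theorem ec_eq_one_iff {a : ZMod 5} : ec a = 1 ↔ a = 0 := by
  rw [← AddChar.map_zero_eq_one ec]
  exact ZMod.injective_stdAddChar.eq_iff

theorem sum_ec_hom {G : Type*} [AddCommGroup G] [Fintype G] (L : G →+ ZMod 5) [Decidable (L = 0)] :
    ∑ a, ec (L a) = if L = 0 then (Fintype.card G : ℂ) else 0 := by
  classical
  have h := AddChar.sum_eq_ite (ec.compAddMonoidHom L)
  simp only [AddChar.compAddMonoidHom_apply] at h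
  rw [h]
  refine if_congr ?_ rfl rfl
  constructor
  · intro h0
    ext a
    have := DFunLike.congr_fun h0 a
    simpa [ec_eq_one_iff] using this
  · rintro rfl
    ext a
    simp

theorem sum_ec_dotProduct {n : ℕ} (x : V n) :
    ∑ ξ : V n, ec (ξ ⬝ᵥ x) = if x = 0 then (cardV n : ℂ) else 0 := by
  classical
  let L : V n →+ ZMod 5 :=
    { toFun := fun ξ => ξ ⬝ᵥ x, map_zero' := zero_dotProduct x,
      map_add' := fun a b => add_dotProduct a b x }
  have h := sum_ec_hom L
  have hL : L = 0 ↔ x = 0 := by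
    constructor
    · intro h0
      ext i
      simpa [L] using DFunLike.congr_fun h0 (Pi.single i 1)
    · rintro rfl
      ext a
      simp [L]
  simp only [hL] at h
  simpa [cardV, L] using h

/-- The hypothesis is a Fourier series with given coefficients, the form in which `parAvg_eq`
supplies it. -/
theorem fourier_inversion {n : ℕ} {a c : V n → ℂ} (h : ∀ y, c y = ∑ η, a η * ec (η ⬝ᵥ y))
    (ξ : V n) : ∑ y, c y * ec (-(ξ ⬝ᵥ y)) = cardV n * a ξ := by
  classical
  have : ∀ y, c y * ec (-(ξ ⬝ᵥ y)) = ∑ η, a η * ec (y ⬝ᵥ (η - ξ)) := by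
    intro y
    rw [h, sum_mul]
    refine sum_congr rfl fun η _ => ?_
    rw [mul_assoc, ← AddChar.map_add_eq_mul, dotProduct_comm y, sub_dotProduct, sub_eq_add_neg]
  simp_rw [this]
  rw [sum_comm]
  simp_rw [← mul_sum, sum_ec_dotProduct, sub_eq_zero]
  simp [mul_comm]

theorem parseval {n : ℕ} {a c : V n → ℂ} (h : ∀ y, c y = ∑ η, a η * ec (η ⬝ᵥ y)) :
    ∑ y, ‖c y‖ ^ 2 = cardV n * ∑ η, ‖a η‖ ^ 2 := by
  have h1 : ∑ y, (‖c y‖ : ℂ) ^ 2 = cardV n * ∑ η, (‖a η‖ : ℂ) ^ 2 := by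
    have h2 : ∀ y, (‖c y‖ : ℂ) ^ 2 =
        ∑ η, (starRingEnd ℂ) (a η) * (c y * ec (-(η ⬝ᵥ y))) := by
      intro y
      rw [← Complex.mul_conj']
      nth_rewrite 2 [h]
      rw [map_sum, mul_sum]
      refine sum_congr rfl fun η _ => ?_
      rw [map_mul, conj_ec]
      ring
    simp_rw [h2]
    rw [sum_comm, mul_sum]
    refine sum_congr rfl fun η _ => ?_
    rw [← mul_sum, fourier_inversion h, ← Complex.mul_conj']
    ring
  exact_mod_cast h1

/-- Wiener–Khinchin: the power spectrum is dual to the autocorrelation. -/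
theorem sum_norm_sq_fourier {n : ℕ} (g : V n → ℂ) (y : V n) :
    ∑ η : V n, ((‖∑ x, g x * ec (η ⬝ᵥ x)‖ ^ 2 : ℝ) : ℂ) * ec (η ⬝ᵥ y) =
      cardV n * ∑ x, g x * (starRingEnd ℂ) (g (x + y)) := by
  classical
  have : ∀ η : V n, ((‖∑ x, g x * ec (η ⬝ᵥ x)‖ ^ 2 : ℝ) : ℂ) * ec (η ⬝ᵥ y) =
      ∑ x, ∑ z, g x * (starRingEnd ℂ) (g z) * ec (η ⬝ᵥ (x + y - z)) := by
    intro η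
    rw [Complex.ofReal_pow, ← Complex.mul_conj', map_sum, sum_mul_sum, sum_mul]
    refine sum_congr rfl fun x _ => ?_
    rw [sum_mul]
    refine sum_congr rfl fun z _ => ?_
    rw [map_mul, conj_ec, dotProduct_sub, dotProduct_add, sub_eq_add_neg,
      AddChar.map_add_eq_mul, AddChar.map_add_eq_mul]
    ring
  simp_rw [this]
  rw [sum_comm, mul_sum]
  refine sum_congr rfl fun x _ => ?_
  rw [sum_comm]
  simp_rw [← mul_sum, sum_ec_dotProduct, sub_eq_zero]
  simp [mul_comm, mul_left_comm]

/-! ### The ambiguity function -/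

/-- The squared Fourier coefficients of the multiplicative derivatives of `f`. -/
def amb {n : ℕ} (f : V n → ℝ) (v : V n × V n) : ℝ :=
  ‖∑ x, ((f x * f (x + v.1) : ℝ) : ℂ) * ec (v.2 ⬝ᵥ x)‖ ^ 2 / cardV n ^ 2

/-- The averages of `f` over parallelograms with given side vectors. -/
def parAvg {n : ℕ} (f : V n → ℝ) (h y : V n) : ℝ :=
  (∑ x, f x * f (x + h) * (f (x + y) * f (x + y + h))) / cardV n

theorem amb_nonneg {n : ℕ} (f : V n → ℝ) (v : V n × V n) : 0 ≤ amb f v := by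
  unfold amb; positivity

theorem parAvg_comm {n : ℕ} (f : V n → ℝ) (h y : V n) : parAvg f h y = parAvg f y h := by
  unfold parAvg
  congr 1
  refine sum_congr rfl fun x _ => ?_
  rw [add_right_comm x y h]
  ring

theorem parAvg_eq {n : ℕ} (f : V n → ℝ) (h y : V n) :
    (parAvg f h y : ℂ) = ∑ η, (amb f (h, η) : ℂ) * ec (η ⬝ᵥ y) := by
  have H := sum_norm_sq_fourier (fun x => ((f x * f (x + h) : ℝ) : ℂ)) y
  have hN := cardV_ne_zero n
  have : ∀ η, (amb f (h, η) : ℂ) * ec (η ⬝ᵥ y) =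
      (((‖∑ x, ((f x * f (x + h) : ℝ) : ℂ) * ec (η ⬝ᵥ x)‖ ^ 2 : ℝ) : ℂ) * ec (η ⬝ᵥ y))
        / (cardV n : ℂ) ^ 2 := by
    intro η
    simp only [amb]
    push_cast
    ring
  simp_rw [this]
  rw [← sum_div, H]
  simp only [parAvg, Complex.conj_ofReal]
  push_cast
  field_simp

theorem amb_eq {n : ℕ} (f : V n → ℝ) (h ξ : V n) :
    ∑ y, (parAvg f h y : ℂ) * ec (-(ξ ⬝ᵥ y)) = cardV n * amb f (h, ξ) :=
  fourier_inversion (fun y => parAvg_eq f h y) ξ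

/-- The character of `𝔽₅ⁿ × 𝔽₅ⁿ` which is symplectically dual to `w`. -/
def sympChar {n : ℕ} (w : V n × V n) : AddChar (V n × V n) ℂ :=
  ec.compAddMonoidHom
    { toFun := fun v => w.2 ⬝ᵥ v.1 - v.2 ⬝ᵥ w.1
      map_zero' := by simp
      map_add' := fun a b => by
        simp only [Prod.fst_add, Prod.snd_add, dotProduct_add, add_dotProduct]
        abel }

theorem sympChar_apply {n : ℕ} (w v : V n × V n) :
    sympChar w v = ec (w.2 ⬝ᵥ v.1 - v.2 ⬝ᵥ w.1) := rfl

/-- The ambiguity function is its own symplectic Fourier transform. -/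
theorem amb_self_dual {n : ℕ} (f : V n → ℝ) (v : V n × V n) :
    (amb f v : ℂ) = ∑ w, ((amb f w / cardV n : ℝ) : ℂ) * sympChar w v := by
  have hN := cardV_ne_zero n
  obtain ⟨h, ξ⟩ := v
  have H := amb_eq f h ξ
  have : ∑ w, ((amb f w / cardV n : ℝ) : ℂ) * sympChar w (h, ξ) =
      (∑ y, (parAvg f h y : ℂ) * ec (-(ξ ⬝ᵥ y))) / cardV n := by
    rw [Fintype.sum_prod_type, sum_div]
    refine sum_congr rfl fun y _ => ?_
    -- Self-duality comes from the symmetry of a parallelogram in its two sides: the average is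
    -- expanded in h rather than in y.
    rw [parAvg_comm, parAvg_eq, sum_mul, sum_div]
    refine sum_congr rfl fun η _ => ?_
    rw [sympChar_apply, sub_eq_add_neg, AddChar.map_add_eq_mul]
    push_cast
    ring
  rw [this, H]
  field_simp

theorem sum_amb_fiber {n : ℕ} {f : V n → ℝ} (hf : ∀ x, |f x| ≤ 1) (h : V n) :
    ∑ ξ, amb f (h, ξ) ≤ 1 := by
  have h1 := parAvg_eq f h 0
  simp only [dotProduct_zero, AddChar.map_zero_eq_one, mul_one] at h1
  have h2 : ∑ ξ, amb f (h, ξ) = parAvg f h 0 := by exact_mod_cast h1.symm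
  rw [h2, parAvg, div_le_one (cardV_pos n)]
  calc _ ≤ ∑ x : V n, (1 : ℝ) := by
        refine sum_le_sum fun x _ => (le_abs_self _).trans ?_
        simp only [abs_mul]
        have h1 := mul_le_one₀ (hf x) (abs_nonneg _) (hf (x + h))
        have h2 := mul_le_one₀ (hf (x + 0)) (abs_nonneg _) (hf (x + 0 + h))
        exact mul_le_one₀ h1 (by positivity) h2
    _ = cardV n := by simp [cardV]

theorem amb_le_one {n : ℕ} {f : V n → ℝ} (hf : ∀ x, |f x| ≤ 1) (v : V n × V n) :
    amb f v ≤ 1 :=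
  (single_le_sum (f := fun ξ => amb f (v.1, ξ)) (fun _ _ => amb_nonneg f _)
    (mem_univ v.2)).trans (sum_amb_fiber hf v.1)

theorem sum_amb {n : ℕ} {f : V n → ℝ} (hf : ∀ x, |f x| ≤ 1) : ∑ v, amb f v ≤ cardV n := by
  rw [Fintype.sum_prod_type]
  refine (sum_le_sum fun h _ => sum_amb_fiber hf h).trans ?_
  simp [cardV]

theorem sum_parAvg_sq {n : ℕ} (f : V n → ℝ) (h : V n) :
    ∑ y, parAvg f h y ^ 2 = cardV n * ∑ ξ, amb f (h, ξ) ^ 2 := by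
  have := parseval (fun y => parAvg_eq f h y)
  simpa only [Complex.norm_real, Real.norm_eq_abs, sq_abs] using this

/-- The eighth power of the Gowers norm. -/
def u3Pow {n : ℕ} (f : V n → ℝ) : ℝ :=
  𝔼 x, 𝔼 h₁, 𝔼 h₂, 𝔼 h₃,
    f x * f (x + h₁) * f (x + h₂) * f (x + h₃) *
      f (x + h₁ + h₂) * f (x + h₁ + h₃) * f (x + h₂ + h₃) *
      f (x + h₁ + h₂ + h₃)

/-- A 3-cube is a pair of parallelograms with sides h₁, h₂, one the translate of the other by h₃.
Summing over x and h₃ gives the square of a parallelogram average; Parseval in h₂ does the rest. -/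
theorem u3Pow_eq {n : ℕ} (f : V n → ℝ) : u3Pow f = (∑ v, amb f v ^ 2) / cardV n := by
  have hN := (cardV_pos n).ne'
  have h1 : u3Pow f = (∑ x, ∑ h₁, ∑ h₂, ∑ h₃,
      f x * f (x + h₁) * f (x + h₂) * f (x + h₃) *
      f (x + h₁ + h₂) * f (x + h₁ + h₃) * f (x + h₂ + h₃) *
      f (x + h₁ + h₂ + h₃)) / cardV n ^ 4 := by
    simp only [u3Pow, Fintype.expect_eq_sum_div_card, ← sum_div, cardV]
    field_simp
  have h2 : ∀ h₁ h₂, ∑ x, ∑ h₃, f x * f (x + h₁) * f (x + h₂) * f (x + h₃) *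
      f (x + h₁ + h₂) * f (x + h₁ + h₃) * f (x + h₂ + h₃) *
      f (x + h₁ + h₂ + h₃) = (cardV n * parAvg f h₁ h₂) ^ 2 := by
    intro h₁ h₂
    have h3 : cardV n * parAvg f h₁ h₂ =
        ∑ x, f x * f (x + h₁) * (f (x + h₂) * f (x + h₂ + h₁)) := by
      unfold parAvg
      field_simp
    rw [h3, sq, sum_mul]
    refine sum_congr rfl fun x _ => ?_
    rw [← Equiv.sum_comp (Equiv.addLeft x)
      (fun x => f x * f (x + h₁) * (f (x + h₂) * f (x + h₂ + h₁))), mul_sum]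
    refine sum_congr rfl fun h₃ _ => ?_
    simp only [Equiv.coe_addLeft]
    rw [add_right_comm x h₃ h₁, add_right_comm x h₃ h₂, add_right_comm (x + h₂) h₃ h₁,
      add_right_comm x h₂ h₁]
    ring
  rw [h1]
  have h4 : ∑ x, ∑ h₁, ∑ h₂, ∑ h₃,
      f x * f (x + h₁) * f (x + h₂) * f (x + h₃) *
      f (x + h₁ + h₂) * f (x + h₁ + h₃) * f (x + h₂ + h₃) *
      f (x + h₁ + h₂ + h₃) = cardV n ^ 3 * ∑ v, amb f v ^ 2 := by
    rw [sum_comm, Fintype.sum_prod_type, mul_sum]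
    refine sum_congr rfl fun h₁ _ => ?_
    rw [sum_comm]
    simp_rw [h2, mul_pow]
    rw [← mul_sum, sum_parAvg_sq]
    ring
  rw [h4]
  field_simp

/-! ### Functions with non-negative Fourier transform -/

/-- A character sums over a subgroup to a non-negative real, and translation only multiplies each
term by a unimodular number. -/
theorem sum_coset_le {G H ι : Type*} [AddCommGroup G] [AddCommGroup H] [Fintype H] [Fintype ι] {F : G → ℝ}
    {c : ι → ℝ} {ψ : ι → AddChar G ℂ} (hF : ∀ v, (F v : ℂ) = ∑ w, (c w : ℂ) * ψ w v)
    (hc : ∀ w, 0 ≤ c w) (φ : H →+ G) (v : G) (hv : ∀ w, ‖ψ w v‖ = 1) :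
    ∑ h : H, F (v + φ h) ≤ ∑ h : H, F (φ h) := by
  classical
  have key : ∀ w, ∃ s : ℝ, 0 ≤ s ∧ ∑ h : H, ψ w (φ h) = s := by
    intro w
    have h := AddChar.sum_eq_ite ((ψ w).compAddMonoidHom φ)
    simp only [AddChar.compAddMonoidHom_apply] at h
    rw [h]
    split_ifs
    · exact ⟨Fintype.card H, Nat.cast_nonneg _, by simp⟩
    · exact ⟨0, le_rfl, by simp⟩
  choose s hs0 hs using key
  have h1 : ((∑ h : H, F (v + φ h) : ℝ) : ℂ) = ∑ w, (c w : ℂ) * ψ w v * s w := by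
    push_cast
    simp_rw [hF, ← hs]
    rw [sum_comm]
    refine sum_congr rfl fun w _ => ?_
    rw [mul_sum]
    refine sum_congr rfl fun h _ => ?_
    rw [AddChar.map_add_eq_mul, mul_assoc]
  have h2 : ((∑ h : H, F (φ h) : ℝ) : ℂ) = ((∑ w, c w * s w : ℝ) : ℂ) := by
    push_cast
    simp_rw [hF, ← hs]
    rw [sum_comm]
    exact sum_congr rfl fun w _ => (mul_sum _ _ _).symm
  rw [Complex.ofReal_inj] at h2
  rw [h2]
  calc ∑ h : H, F (v + φ h) ≤ ‖((∑ h : H, F (v + φ h) : ℝ) : ℂ)‖ := by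
        rw [Complex.norm_real]; exact le_abs_self _
    _ ≤ ∑ w, ‖(c w : ℂ) * ψ w v * s w‖ := by rw [h1]; exact norm_sum_le _ _
    _ = ∑ w, c w * s w := by
        refine sum_congr rfl fun w _ => ?_
        rw [norm_mul, norm_mul, hv, Complex.norm_real, Complex.norm_real, Real.norm_eq_abs,
          Real.norm_eq_abs, abs_of_nonneg (hc w), abs_of_nonneg (hs0 w), mul_one]

/-- Cauchy–Schwarz on the Fourier side with weights c, whose total is F 0. -/
theorem sq_sum_le_sum_sub {G ι : Type*} [AddCommGroup G] [Finite G] [Fintype ι] {F : G → ℝ}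
    {c : ι → ℝ} {ψ : ι → AddChar G ℂ} (hF : ∀ v, (F v : ℂ) = ∑ w, (c w : ℂ) * ψ w v)
    (hc : ∀ w, 0 ≤ c w) (S : Finset G)
    (hS : 0 ≤ ∑ v ∈ S, F v) :
    (∑ v ∈ S, F v) ^ 2 ≤ F 0 * ∑ v ∈ S, ∑ v' ∈ S, F (v - v') := by
  have h0 : F 0 = ∑ w, c w := by
    have := hF 0
    simp only [AddChar.map_zero_eq_one, mul_one] at this
    exact_mod_cast this
  have h1 : ∑ v ∈ S, F v ≤ ∑ w, c w * ‖∑ v ∈ S, ψ w v‖ := by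
    calc ∑ v ∈ S, F v ≤ ‖((∑ v ∈ S, F v : ℝ) : ℂ)‖ := by
          rw [Complex.norm_real]; exact le_abs_self _
      _ = ‖∑ w, (c w : ℂ) * ∑ v ∈ S, ψ w v‖ := by
          push_cast
          simp_rw [hF, mul_sum]
          rw [sum_comm]
      _ ≤ _ := by
          refine (norm_sum_le _ _).trans (sum_le_sum fun w _ => ?_)
          rw [norm_mul, Complex.norm_real, Real.norm_eq_abs, abs_of_nonneg (hc w)]
  have h2 : ∑ v ∈ S, ∑ v' ∈ S, F (v - v') = ∑ w, c w * ‖∑ v ∈ S, ψ w v‖ ^ 2 := by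
    have : ((∑ v ∈ S, ∑ v' ∈ S, F (v - v') : ℝ) : ℂ) =
        ((∑ w, c w * ‖∑ v ∈ S, ψ w v‖ ^ 2 : ℝ) : ℂ) := by
      push_cast
      have h3 : ∀ w, (c w : ℂ) * (‖∑ v ∈ S, ψ w v‖ : ℂ) ^ 2 =
          ∑ v ∈ S, ∑ v' ∈ S, (c w : ℂ) * ψ w (v - v') := by
        intro w
        rw [← Complex.mul_conj', map_sum, sum_mul_sum, mul_sum]
        refine sum_congr rfl fun v _ => ?_
        rw [mul_sum]
        refine sum_congr rfl fun v' _ => ?_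
        rw [sub_eq_add_neg, AddChar.map_add_eq_mul, AddChar.map_neg_eq_conj]
      simp_rw [h3, hF]
      rw [sum_comm (s := (univ : Finset ι))]
      refine sum_congr rfl fun v _ => ?_
      rw [sum_comm]
    exact_mod_cast this
  rw [h0, h2]
  have h4 : (∑ w, c w * ‖∑ v ∈ S, ψ w v‖) ^ 2 ≤
      (∑ w, c w) * ∑ w, c w * ‖∑ v ∈ S, ψ w v‖ ^ 2 :=
    sum_sq_le_sum_mul_sum_of_sq_le_mul _ (fun w _ => hc w)
      (fun w _ => by have := hc w; positivity) fun w _ => le_of_eq (by ring)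
  exact (pow_le_pow_left₀ hS h1 2).trans h4

/-! ### The Balog–Szemerédi–Gowers theorem and Freiman's theorem in torsion groups -/

/-- The number of common neighbours in `S` of `a` and `b`. -/
def codeg {α : Type*} (S : Finset α) (r : α → α → Prop) [DecidableRel r] (a b : α) : ℕ :=
  #{u ∈ S | r a u ∧ r b u}

/-- Dependent random choice: in a dense graph some vertex has a large neighbourhood in which few
pairs have a small number of common neighbours. -/
theorem exists_neighborhood_few_bad {α : Type*} (S : Finset α) (r : α → α → Prop)
    [DecidableRel r] {δ : ℝ} (hδ : 0 < δ) (hS : S.Nonempty)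
    (hr : δ * (#S : ℝ) ^ 2 ≤ ∑ u ∈ S, (#{a ∈ S | r a u} : ℝ)) :
    ∃ A ⊆ S, δ / 2 * #S ≤ #A ∧
      (∑ a ∈ A, (#{b ∈ A | (codeg S r a b : ℝ) < δ ^ 2 / 16 * #S} : ℝ)) ≤ (#A : ℝ) ^ 2 / 8 := by
  have hS0 : (0 : ℝ) < #S := by exact_mod_cast hS.card_pos
  let A : α → Finset α := fun u => {a ∈ S | r a u}
  let bad : α → α → Prop := fun a b => (codeg S r a b : ℝ) < δ ^ 2 / 16 * #S
  have hsq : δ ^ 2 * (#S : ℝ) ^ 3 ≤ ∑ u ∈ S, (#(A u) : ℝ) ^ 2 := by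
    have h1 := sq_sum_le_card_mul_sum_sq (s := S) (f := fun u => (#(A u) : ℝ))
    have h2 := pow_le_pow_left₀ (by positivity) hr 2
    have h3 : (#S : ℝ) * (δ ^ 2 * (#S : ℝ) ^ 3) ≤ #S * ∑ u ∈ S, (#(A u) : ℝ) ^ 2 :=
      le_trans (le_trans (le_of_eq (by ring)) h2) h1
    exact le_of_mul_le_mul_left h3 hS0
  have hbad : ∑ u ∈ S, ∑ a ∈ A u, (#{b ∈ A u | bad a b} : ℝ) ≤
      δ ^ 2 / 16 * (#S : ℝ) ^ 3 := by
    have h1 : ∀ u, ∑ a ∈ A u, (#{b ∈ A u | bad a b} : ℝ) =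
        ∑ a ∈ S, ∑ b ∈ S, if bad a b then (if r a u ∧ r b u then (1 : ℝ) else 0) else 0 := by
      intro u
      simp only [A]
      rw [sum_filter]
      refine sum_congr rfl fun a _ => ?_
      rw [filter_filter, card_filter]
      push_cast
      by_cases ha : r a u
      · simp only [ha, if_true, true_and]
        refine sum_congr rfl fun b _ => ?_
        by_cases hb : r b u <;> simp [hb]
      · simp [ha]
    simp_rw [h1]
    rw [sum_comm]
    have h2 : ∀ a ∈ S, ∑ u ∈ S, ∑ b ∈ S,
        (if bad a b then (if r a u ∧ r b u then (1 : ℝ) else 0) else 0) ≤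
        #S * (δ ^ 2 / 16 * #S) := by
      intro a _
      rw [sum_comm, ← nsmul_eq_mul]
      refine sum_le_card_nsmul _ _ _ fun b _ => ?_
      by_cases hb : bad a b
      · simp only [hb, if_true]
        have : ∑ u ∈ S, (if r a u ∧ r b u then (1 : ℝ) else 0) = codeg S r a b := by
          simp [codeg]
        rw [this]
        exact hb.le
      · simp only [hb, if_false, sum_const_zero]
        positivity
    refine (sum_le_card_nsmul _ _ _ h2).trans (le_of_eq ?_)
    rw [nsmul_eq_mul]
    ring
  -- The weight 8 is chosen so that bad pairs cost at most 8 · δ²/16 = δ²/2 of the average of |A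
  -- u|²; a good u then yields both the size and the sparsity of bad pairs.
  have hex : ∃ u ∈ S, δ ^ 2 / 2 * (#S : ℝ) ^ 2 ≤
      (#(A u) : ℝ) ^ 2 - 8 * ∑ a ∈ A u, (#{b ∈ A u | bad a b} : ℝ) := by
    refine exists_le_of_sum_le hS ?_
    rw [sum_const, nsmul_eq_mul, sum_sub_distrib, ← mul_sum]
    nlinarith
  obtain ⟨u, -, hu⟩ := hex
  have hb0 : 0 ≤ ∑ a ∈ A u, (#{b ∈ A u | bad a b} : ℝ) := sum_nonneg fun _ _ => Nat.cast_nonneg _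
  refine ⟨A u, filter_subset _ _, ?_, ?_⟩
  · refine le_of_sq_le_sq ?_ (Nat.cast_nonneg _)
    nlinarith [sq_nonneg (δ * (#S : ℝ))]
  · have : 0 ≤ δ ^ 2 / 2 * (#S : ℝ) ^ 2 := by positivity
    change ∑ a ∈ A u, (#{b ∈ A u | bad a b} : ℝ) ≤ _
    linarith

/-- In a dense graph there is a large set of vertices any two of which are joined by many paths
of length four. -/
theorem exists_many_paths {α : Type*} (S : Finset α) (r : α → α → Prop)
    [DecidableRel r] {δ : ℝ} (hδ : 0 < δ) (hS : S.Nonempty)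
    (hr : δ * (#S : ℝ) ^ 2 ≤ ∑ u ∈ S, (#{a ∈ S | r a u} : ℝ)) :
    ∃ A ⊆ S, δ / 4 * #S ≤ #A ∧ ∀ a ∈ A, ∀ a' ∈ A, δ / 4 * #S ≤
      #{b ∈ S | δ ^ 2 / 16 * #S ≤ codeg S r a b ∧ δ ^ 2 / 16 * #S ≤ codeg S r a' b} := by
  obtain ⟨A, hAS, hA, hbad⟩ := exists_neighborhood_few_bad S r hδ hS hr
  have hS0 : (0 : ℝ) < #S := by exact_mod_cast hS.card_pos
  have hA0 : (0 : ℝ) < #A := lt_of_lt_of_le (by positivity) hA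
  let bad : α → α → Prop := fun a b => (codeg S r a b : ℝ) < δ ^ 2 / 16 * #S
  -- By Markov at most half of A has over |A|/4 bad partners. Two surviving vertices share at least
  -- |A|/2 good partners.
  let A' : Finset α := {a ∈ A | (#{b ∈ A | bad a b} : ℝ) ≤ #A / 4}
  have hsplit : #A' + #{a ∈ A | ¬ (#{b ∈ A | bad a b} : ℝ) ≤ #A / 4} = #A :=
    card_filter_add_card_filter_not _
  have hfew : (#{a ∈ A | ¬ (#{b ∈ A | bad a b} : ℝ) ≤ #A / 4} : ℝ) * (#A / 4) ≤
      (#A : ℝ) ^ 2 / 8 := by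
    refine le_trans ?_ hbad
    rw [← nsmul_eq_mul]
    refine (card_nsmul_le_sum _ (fun a => (#{b ∈ A | bad a b} : ℝ)) _ fun a ha => ?_).trans
      (sum_le_sum_of_subset_of_nonneg (filter_subset _ _) fun _ _ _ => Nat.cast_nonneg _)
    exact (not_le.1 (mem_filter.1 ha).2).le
  have hcard : (#A : ℝ) / 2 ≤ #A' := by
    have h1 : (#{a ∈ A | ¬ (#{b ∈ A | bad a b} : ℝ) ≤ #A / 4} : ℝ) ≤ #A / 2 := by
      by_contra h
      nlinarith [not_le.1 h]
    have h2 : (#A' : ℝ) + #{a ∈ A | ¬ (#{b ∈ A | bad a b} : ℝ) ≤ #A / 4} = #A := by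
      exact_mod_cast hsplit
    linarith
  refine ⟨A', (filter_subset _ _).trans hAS, by linarith, fun a ha a' ha' => ?_⟩
  have h1 := (mem_filter.1 ha).2
  have h2 := (mem_filter.1 ha').2
  classical
  have hcover : A ⊆ ({b ∈ A | bad a b} ∪ {b ∈ A | bad a' b}) ∪
      {b ∈ S | δ ^ 2 / 16 * #S ≤ codeg S r a b ∧ δ ^ 2 / 16 * #S ≤ codeg S r a' b} := by
    intro b hb
    have hbS := hAS hb
    simp only [bad, mem_union, mem_filter, hb, hbS, true_and]
    by_cases h3 : (codeg S r a b : ℝ) < δ ^ 2 / 16 * #S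
    · exact Or.inl (Or.inl h3)
    · by_cases h4 : (codeg S r a' b : ℝ) < δ ^ 2 / 16 * #S
      · exact Or.inl (Or.inr h4)
      · exact Or.inr ⟨not_lt.1 h3, not_lt.1 h4⟩
  have h5 := (card_le_card hcover).trans ((card_union_le _ _).trans
    (Nat.add_le_add_right (card_union_le _ _) _))
  have h6 : (#A : ℝ) ≤ #{b ∈ A | bad a b} + #{b ∈ A | bad a' b} +
    #{b ∈ S | δ ^ 2 / 16 * #S ≤ codeg S r a b ∧ δ ^ 2 / 16 * #S ≤ codeg S r a' b} := by
    exact_mod_cast h5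
  linarith

open scoped Pointwise in
/-- The Balog–Szemerédi–Gowers theorem. -/
theorem exists_subset_card_sub_le {G : Type*} [AddCommGroup G] [DecidableEq G] (S P : Finset G)
    (hS : S.Nonempty) (hP : ∀ x ∈ P, -x ∈ P) {δ L : ℝ} (hδ : 0 < δ)
    (hr : δ * (#S : ℝ) ^ 2 ≤ ∑ u ∈ S, (#{a ∈ S | a - u ∈ P} : ℝ)) (hL : (#P : ℝ) ≤ L * #S) :
    ∃ A ⊆ S, δ / 4 * #S ≤ #A ∧ (#(A - A) : ℝ) ≤ 4096 * L ^ 4 / δ ^ 6 * #A := by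
  obtain ⟨A, hAS, hA, hpath⟩ := exists_many_paths S (fun a u => a - u ∈ P) hδ hS hr
  have hS0 : (0 : ℝ) < #S := by exact_mod_cast hS.card_pos
  refine ⟨A, hAS, hA, ?_⟩
  -- Representations of d as a sum of four elements of P. A path a, u, b, u', a' gives one for a −
  -- a', so each difference has at least δ⁵|S|³/1024 of them, against |P|⁴ in total.
  let T : G → Finset (G × G × G) := fun d => {p ∈ P ×ˢ P ×ˢ P | d - p.1 - p.2.1 - p.2.2 ∈ P}
  have hT : ∀ d ∈ A - A, δ / 4 * #S * (δ ^ 2 / 16 * #S) ^ 2 ≤ (#(T d) : ℝ) := by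
    intro d hd
    obtain ⟨a, ha, a', ha', rfl⟩ := mem_sub.1 hd
    let r : G → G → Prop := fun a u => a - u ∈ P
    let B : Finset G :=
      {b ∈ S | δ ^ 2 / 16 * #S ≤ codeg S r a b ∧ δ ^ 2 / 16 * #S ≤ codeg S r a' b}
    have hB : δ / 4 * #S ≤ (#B : ℝ) := hpath a ha a' ha'
    let Q : Finset (Σ _ : G, G × G) :=
      B.sigma fun b => {u ∈ S | r a u ∧ r b u} ×ˢ {u ∈ S | r a' u ∧ r b u}
    have hQ : #Q ≤ #(T (a - a')) := by
      refine card_le_card_of_injOn (fun q => (a - q.2.1, q.2.1 - q.1, q.1 - q.2.2)) ?_ ?_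
      · rintro ⟨b, u, u'⟩ hq
        simp only [Q, r, coe_sigma, Set.mem_sigma_iff, mem_coe, mem_product, mem_filter] at hq
        obtain ⟨-, ⟨-, h1, h2⟩, -, h3, h4⟩ := hq
        simp only [T, coe_filter, mem_product, Set.mem_ofPred_eq]
        refine ⟨⟨h1, ?_, h4⟩, ?_⟩
        · simpa using hP _ h2
        · have := hP _ h3
          convert this using 1
          abel
      · rintro ⟨b, u, u'⟩ - ⟨c, w, w'⟩ - h
        simp only [Prod.mk.injEq] at h
        obtain ⟨h1, h2, h3⟩ := h
        obtain rfl : u = w := sub_right_injective h1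
        obtain rfl : b = c := sub_right_injective h2
        obtain rfl : u' = w' := sub_right_injective h3
        rfl
    have hQ' : (#B : ℝ) * (δ ^ 2 / 16 * #S) ^ 2 ≤ #Q := by
      rw [card_sigma, Nat.cast_sum, ← nsmul_eq_mul]
      refine card_nsmul_le_sum _ _ _ fun b hb => ?_
      have hb' := (mem_filter.1 hb).2
      rw [card_product, Nat.cast_mul, sq]
      exact mul_le_mul hb'.1 hb'.2 (by positivity) (Nat.cast_nonneg _)
    calc δ / 4 * #S * (δ ^ 2 / 16 * #S) ^ 2 ≤ (#B : ℝ) * (δ ^ 2 / 16 * #S) ^ 2 := by gcongr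
      _ ≤ (#Q : ℝ) := hQ'
      _ ≤ _ := by exact_mod_cast hQ
  have hsum : ∑ d ∈ A - A, #(T d) ≤ #P ^ 4 := by
    have h1 : #((A - A).sigma T) ≤ #(P ×ˢ P ×ˢ P ×ˢ P) := by
      refine card_le_card_of_injOn
        (fun q => (q.2.1, q.2.2.1, q.2.2.2, q.1 - q.2.1 - q.2.2.1 - q.2.2.2)) ?_ ?_
      · rintro ⟨d, p, q, s⟩ h
        simp only [T, coe_sigma, Set.mem_sigma_iff, mem_coe, mem_product, mem_filter] at h
        simp only [coe_product, Set.mem_prod, mem_coe]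
        exact ⟨h.2.1.1, h.2.1.2.1, h.2.1.2.2, h.2.2⟩
      · rintro ⟨d, p, q, s⟩ - ⟨d', p', q', s'⟩ - h
        simp only [Prod.mk.injEq] at h
        obtain ⟨rfl, rfl, rfl, h4⟩ := h
        obtain rfl : d = d' := by simpa using h4
        rfl
    rw [card_sigma] at h1
    refine h1.trans (le_of_eq ?_)
    simp only [card_product]
    ring
  have hsum' : (#(A - A) : ℝ) * (δ / 4 * #S * (δ ^ 2 / 16 * #S) ^ 2) ≤ (#P : ℝ) ^ 4 := by
    rw [← nsmul_eq_mul]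
    refine (card_nsmul_le_sum _ _ _ hT).trans ?_
    exact_mod_cast hsum
  have hL4 : (#P : ℝ) ^ 4 ≤ (L * #S) ^ 4 := pow_le_pow_left₀ (Nat.cast_nonneg _) hL 4
  have h1 : (#(A - A) : ℝ) ≤ 1024 * L ^ 4 / δ ^ 5 * #S := by
    rw [div_mul_eq_mul_div, le_div_iff₀ (by positivity)]
    refine le_of_mul_le_mul_right (a := (#S : ℝ) ^ 3) ?_ (by positivity)
    have := hsum'.trans hL4
    nlinarith
  refine h1.trans ?_
  calc 1024 * L ^ 4 / δ ^ 5 * #S = 4096 * L ^ 4 / δ ^ 6 * (δ / 4 * #S) := by field_simp; ring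
    _ ≤ _ := by gcongr

open scoped Pointwise in
/-- Freiman's theorem for vector spaces over `𝔽₅`. -/
theorem exists_addSubgroup_card_le {G : Type*} [AddCommGroup G] [Module (ZMod 5) G] [Finite G]
    [DecidableEq G] {A : Finset G} (hA : A.Nonempty) {K : ℕ} (hK : #(A - A) ≤ K * #A) :
    ∃ H : AddSubgroup G, (∀ a ∈ A, ∀ b ∈ A, a - b ∈ H) ∧
      Nat.card H ≤ 5 ^ K ^ 5 * (K * #A) := by
  have : Fact (Nat.Prime 5) := ⟨by norm_num⟩
  have hA0 : (0 : ℚ≥0) < #A := by exact_mod_cast hA.card_pos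
  have hplu := pluennecke_ruzsa_inequality_nsmul_sub_nsmul_sub hA A 3 2
  have hK' : (#(A - A) : ℚ≥0) / #A ≤ K := by
    rw [div_le_iff₀ hA0]
    exact_mod_cast hK
  have h1 : #((2 • A - 2 • A) + A) ≤ K ^ 5 * #A := by
    have h2 : (2 • A - 2 • A) + A = 3 • A - 2 • A := by
      rw [sub_add_eq_add_sub, ← succ_nsmul]
    rw [h2]
    have : (#(3 • A - 2 • A) : ℚ≥0) ≤ (K : ℚ≥0) ^ 5 * #A :=
      hplu.trans (by gcongr)
    exact_mod_cast this
  obtain ⟨X, -, hX, hcov⟩ := ruzsa_covering_add (K := (K : ℝ) ^ 5) hA (by exact_mod_cast h1)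
  have hX' : #X ≤ K ^ 5 := by exact_mod_cast hX
  let Y : Finset G := A - A
  have hYneg : ∀ y ∈ Y, -y ∈ Y := by
    intro y hy
    obtain ⟨a, ha, b, hb, rfl⟩ := mem_sub.1 hy
    rw [neg_sub]
    exact sub_mem_sub hb ha
  have hYadd : ∀ y ∈ Y, ∀ z ∈ Y, ∃ x ∈ X, ∃ w ∈ Y, y + z = x + w := by
    intro y hy z hz
    obtain ⟨a, ha, b, hb, rfl⟩ := mem_sub.1 hy
    obtain ⟨c, hc, d, hd, rfl⟩ := mem_sub.1 hz
    have : a - b + (c - d) ∈ 2 • A - 2 • A := by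
      rw [sub_add_sub_comm, two_nsmul]
      exact sub_mem_sub (add_mem_add ha hc) (add_mem_add hb hd)
    obtain ⟨x, hx, w, hw, h⟩ := mem_add.1 (hcov this)
    exact ⟨x, hx, w, hw, h.symm⟩
  let W : Submodule (ZMod 5) G := Submodule.span (ZMod 5) (X : Set G)
  have hXW : ∀ x ∈ X, x ∈ W := fun x hx => Submodule.subset_span hx
  obtain ⟨a₀, ha₀⟩ := hA
  -- With Y = A − A, covering gives Y + Y ⊆ X + Y, so the span of X plus Y is closed under addition.
  let H : AddSubgroup G :=
    { carrier := {g | ∃ w ∈ W, ∃ y ∈ Y, g = w + y}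
      zero_mem' := ⟨0, W.zero_mem, a₀ - a₀, sub_mem_sub ha₀ ha₀, by simp⟩
      add_mem' := by
        rintro _ _ ⟨w, hw, y, hy, rfl⟩ ⟨w', hw', y', hy', rfl⟩
        obtain ⟨x, hx, z, hz, h⟩ := hYadd y hy y' hy'
        refine ⟨w + w' + x, W.add_mem (W.add_mem hw hw') (hXW x hx), z, hz, ?_⟩
        rw [add_add_add_comm, h, add_assoc, add_assoc, add_assoc]
      neg_mem' := by
        rintro _ ⟨w, hw, y, hy, rfl⟩
        exact ⟨-w, W.neg_mem hw, -y, hYneg y hy, neg_add _ _⟩ }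
  refine ⟨H, fun a ha b hb => ⟨0, W.zero_mem, a - b, sub_mem_sub ha hb, by simp⟩, ?_⟩
  have hW : Nat.card W ≤ 5 ^ K ^ 5 := by
    rw [Module.natCard_eq_pow_finrank (K := ZMod 5), Nat.card_zmod]
    exact Nat.pow_le_pow_right (by norm_num) ((finrank_span_finset_le_card X).trans hX')
  have hsurj : Function.Surjective
      (fun p : W × Y => (⟨p.1 + p.2, p.1, p.1.2, p.2, p.2.2, rfl⟩ : H)) := by
    rintro ⟨_, w, hw, y, hy, rfl⟩
    exact ⟨(⟨w, hw⟩, ⟨y, hy⟩), rfl⟩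
  refine (Nat.card_le_card_of_surjective _ hsurj).trans ?_
  rw [Nat.card_prod, Nat.card_eq_fintype_card (α := Y), Fintype.card_coe]
  exact Nat.mul_le_mul hW hK

/-! ### From the `U³` norm to a quadratic phase -/

theorem norm_sympChar {n : ℕ} (w v : V n × V n) : ‖sympChar w v‖ = 1 := AddChar.norm_apply _ _

theorem amb_div_nonneg {n : ℕ} (f : V n → ℝ) (w : V n × V n) : 0 ≤ amb f w / cardV n :=
  div_nonneg (amb_nonneg f w) (cardV_pos n).le

theorem sum_amb_coset_le {n : ℕ} {H : Type*} [AddCommGroup H] [Fintype H] (f : V n → ℝ)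
    (φ : H →+ V n × V n) (v : V n × V n) :
    ∑ h, amb f (v + φ h) ≤ ∑ h, amb f (φ h) :=
  sum_coset_le (amb_self_dual f) (amb_div_nonneg f) φ v fun w => norm_sympChar w v

/-- Conjugate the self-duality formula, A being real. This is the symmetry of P needed for
Balog–Szemerédi–Gowers. -/
theorem amb_neg {n : ℕ} (f : V n → ℝ) (v : V n × V n) : amb f (-v) = amb f v := by
  have h1 := amb_self_dual f (-v)
  have h2 := congrArg (starRingEnd ℂ) (amb_self_dual f v)
  rw [Complex.conj_ofReal, map_sum] at h2
  rw [← Complex.ofReal_inj, h1, h2]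
  refine sum_congr rfl fun w _ => ?_
  rw [map_mul, Complex.conj_ofReal, AddChar.map_neg_eq_conj]

theorem sq_sum_amb_le {n : ℕ} {f : V n → ℝ} (hf : ∀ x, |f x| ≤ 1) (S : Finset (V n × V n)) :
    (∑ v ∈ S, amb f v) ^ 2 ≤ ∑ u ∈ S, ∑ v ∈ S, amb f (v - u) := by
  have h1 := sq_sum_le_sum_sub (amb_self_dual f) (amb_div_nonneg f) S
    (sum_nonneg fun v _ => amb_nonneg f v)
  rw [sum_comm] at h1
  exact h1.trans (mul_le_of_le_one_left
    (sum_nonneg fun _ _ => sum_nonneg fun _ _ => amb_nonneg f _) (amb_le_one hf 0))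

open Classical in
/-- The set of large values of the ambiguity function. -/
def largeSpec {n : ℕ} (f : V n → ℝ) (c : ℝ) : Finset (V n × V n) := {v | c ≤ amb f v}

theorem mem_largeSpec {n : ℕ} {f : V n → ℝ} {c : ℝ} {v : V n × V n} :
    v ∈ largeSpec f c ↔ c ≤ amb f v := by
  simp [largeSpec]

theorem card_largeSpec_le {n : ℕ} {f : V n → ℝ} (hf : ∀ x, |f x| ≤ 1) {c : ℝ} (hc : 0 < c) :
    (#(largeSpec f c) : ℝ) ≤ cardV n / c := by
  rw [le_div_iff₀ hc, ← nsmul_eq_mul]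
  exact (card_nsmul_le_sum _ (amb f) _ fun v hv => mem_largeSpec.1 hv).trans
    ((sum_le_sum_of_subset_of_nonneg (subset_univ _) fun v _ _ => amb_nonneg f v).trans
      (sum_amb hf))

theorem le_card_largeSpec {n : ℕ} {f : V n → ℝ} (hf : ∀ x, |f x| ≤ 1) {ε : ℝ} (hε : 0 < ε)
    (hu : ε ≤ u3Pow f) : ε / 2 * cardV n ≤ #(largeSpec f (ε / 2)) := by
  classical
  rw [u3Pow_eq, le_div_iff₀ (cardV_pos n)] at hu
  have h1 : ∀ v, amb f v ^ 2 ≤ (if v ∈ largeSpec f (ε / 2) then 1 else 0) + ε / 2 * amb f v := by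
    intro v
    have h0 := amb_nonneg f v
    have h1 := amb_le_one hf v
    split_ifs with hv
    · nlinarith
    · rw [mem_largeSpec, not_le] at hv
      nlinarith
  have h2 := sum_le_sum fun v (_ : v ∈ univ) => h1 v
  rw [sum_add_distrib, ← mul_sum] at h2
  have h3 := sum_amb hf
  have h4 : ∑ v, (if v ∈ largeSpec f (ε / 2) then (1 : ℝ) else 0) = #(largeSpec f (ε / 2)) := by
    simp
  nlinarith

theorem many_differences {n : ℕ} {f : V n → ℝ} (hf : ∀ x, |f x| ≤ 1) {ε : ℝ} (hε : 0 < ε) :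
    ε ^ 2 / 8 * (#(largeSpec f (ε / 2)) : ℝ) ^ 2 ≤ ∑ u ∈ largeSpec f (ε / 2),
      (#{a ∈ largeSpec f (ε / 2) | a - u ∈ largeSpec f (ε ^ 2 / 8)} : ℝ) := by
  classical
  set S := largeSpec f (ε / 2) with hS
  have h1 : ε / 2 * #S ≤ ∑ v ∈ S, amb f v := by
    rw [mul_comm, ← nsmul_eq_mul]
    exact card_nsmul_le_sum _ _ _ fun v hv => mem_largeSpec.1 hv
  have h2 := (pow_le_pow_left₀ (by positivity) h1 2).trans (sq_sum_amb_le hf S)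
  -- The differences have total mass at least ε²/4 · |S|²; those with A below ε²/8 account for at
  -- most half of this.
  have h3 : ∀ u ∈ S, ∑ v ∈ S, amb f (v - u) ≤
      (#{a ∈ S | a - u ∈ largeSpec f (ε ^ 2 / 8)} : ℝ) + #S * (ε ^ 2 / 8) := by
    intro u _
    rw [card_filter, ← nsmul_eq_mul, ← sum_const, Nat.cast_sum, ← sum_add_distrib]
    refine sum_le_sum fun v _ => ?_
    have h1 := amb_le_one hf (v - u)
    have h2 : 0 < ε ^ 2 / 8 := by positivity
    split_ifs with hv
    · push_cast; linarith
    · rw [mem_largeSpec, not_le] at hv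
      push_cast; linarith
  have h4 := h2.trans (sum_le_sum h3)
  rw [sum_add_distrib, sum_const, nsmul_eq_mul] at h4
  nlinarith

open scoped Pointwise in
theorem exists_addSubgroup_of_u3Pow {ε : ℝ} (hε : 0 < ε) :
    ∃ η : ℝ, 0 < η ∧ ∃ C : ℝ, 0 < C ∧ ∀ (n : ℕ) (f : V n → ℝ), (∀ x, |f x| ≤ 1) →
      ε ≤ u3Pow f → ∃ (H : AddSubgroup (V n × V n)) (_ : Fintype H),
        (Fintype.card H : ℝ) ≤ C * cardV n ∧ η * cardV n ≤ ∑ h : H, amb f h := by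
  classical
  set δ := ε ^ 2 / 8 with hδ
  have hδ0 : 0 < δ := by positivity
  set L := 2 / (δ * ε) with hL
  obtain ⟨K, hK⟩ := exists_nat_gt (4096 * L ^ 4 / δ ^ 6)
  have hK0 : (0 : ℝ) < K := lt_of_le_of_lt (by positivity) hK
  -- The mass bound multiplies the value ε/2 on A, the proportion δ/4 of A in S, and the density ε/2
  -- of S.
  refine ⟨ε / 2 * (δ / 4 * (ε / 2)), by positivity, 5 ^ K ^ 5 * (K * (1 / (ε / 2))),
    by positivity, fun n f hf hu => ?_⟩
  have hN := cardV_pos n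
  set S := largeSpec f (ε / 2) with hS
  have hSlow := le_card_largeSpec hf hε hu
  have hSup := card_largeSpec_le hf (half_pos hε)
  have hS0 : (0 : ℝ) < #S := lt_of_lt_of_le (by positivity) hSlow
  have hPle : (#(largeSpec f δ) : ℝ) ≤ L * #S := by
    refine (card_largeSpec_le hf hδ0).trans ?_
    calc cardV n / δ = L * (ε / 2 * cardV n) := by rw [hL]; field_simp
      _ ≤ _ := by gcongr
  obtain ⟨A, hAS, hA, hAA⟩ := exists_subset_card_sub_le S (largeSpec f δ)
    (card_pos.1 (by exact_mod_cast hS0))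
    (fun x hx => by rw [mem_largeSpec] at hx ⊢; rwa [amb_neg]) hδ0 (many_differences hf hε) hPle
  have hA0 : (0 : ℝ) < #A := lt_of_lt_of_le (by positivity) hA
  have hAne : A.Nonempty := card_pos.1 (by exact_mod_cast hA0)
  obtain ⟨H, hH, hcard⟩ := exists_addSubgroup_card_le hAne (K := K) (by
    have : (#(A - A) : ℝ) ≤ K * #A := hAA.trans (by gcongr)
    exact_mod_cast this)
  refine ⟨H, inferInstance, ?_, ?_⟩
  · rw [Nat.card_eq_fintype_card] at hcard
    have h1 : (Fintype.card H : ℝ) ≤ 5 ^ K ^ 5 * (K * #A) := by exact_mod_cast hcard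
    have h2 : (#A : ℝ) ≤ 1 / (ε / 2) * cardV n := by
      refine le_trans (by exact_mod_cast card_le_card hAS) (hSup.trans (le_of_eq ?_))
      ring
    refine h1.trans ?_
    rw [mul_assoc, mul_assoc]
    gcongr
  · obtain ⟨a₀, ha₀⟩ := hAne
    refine le_trans ?_ (sum_amb_coset_le f H.subtype a₀)
    calc ε / 2 * (δ / 4 * (ε / 2)) * cardV n = δ / 4 * (ε / 2 * cardV n) * (ε / 2) := by ring
      _ ≤ #A * (ε / 2) := by
        gcongr
        exact le_trans (by gcongr) hA
      _ ≤ ∑ a ∈ A, amb f a := by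
        rw [← nsmul_eq_mul]
        exact card_nsmul_le_sum _ _ _ fun v hv => mem_largeSpec.1 (hAS hv)
      _ = ∑ a ∈ A.attach, amb f (a₀ + (⟨a.1 - a₀, hH _ a.2 _ ha₀⟩ : H)) := by
        rw [← sum_attach]
        exact sum_congr rfl fun a _ => by simp
      _ = ∑ h ∈ A.attach.image fun a => (⟨a.1 - a₀, hH _ a.2 _ ha₀⟩ : H), amb f (a₀ + h) := by
        rw [sum_image]
        intro a _ b _ hab
        exact Subtype.ext (sub_left_injective (congrArg Subtype.val hab))
      _ ≤ ∑ h : H, amb f (a₀ + H.subtype h) :=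
        sum_le_sum_of_subset_of_nonneg (subset_univ _) fun _ _ _ => amb_nonneg f _

/-- The graph of a linear map, as a homomorphism. -/
def graphHom {n : ℕ} (T : V n →ₗ[ZMod 5] V n) : V n →+ V n × V n :=
  (LinearMap.id.prod T).toAddMonoidHom

theorem graphHom_apply {n : ℕ} (T : V n →ₗ[ZMod 5] V n) (h : V n) : graphHom T h = (h, T h) :=
  rfl

/-- Each fibre has mass at most 1, so H projects onto at least η5ⁿ points and its vertical part K
has at most C/η elements. H lies in |K| vertical translates of one graph, none heavier than the
graph itself. -/
theorem exists_linearMap_of_addSubgroup {n : ℕ} {f : V n → ℝ} (hf : ∀ x, |f x| ≤ 1)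
    (H : AddSubgroup (V n × V n)) [Fintype H] {η C : ℝ} (hη : 0 < η) (hC : 0 < C)
    (hcard : (Fintype.card H : ℝ) ≤ C * cardV n) (hsum : η * cardV n ≤ ∑ h : H, amb f h) :
    ∃ T : V n →ₗ[ZMod 5] V n, η ^ 2 / C * cardV n ≤ ∑ h, amb f (h, T h) := by
  classical
  have : Fact (Nat.Prime 5) := ⟨by norm_num⟩
  have hN := cardV_pos n
  let H' : Submodule (ZMod 5) (V n × V n) := AddSubgroup.toZModSubmodule 5 H
  let p : H' →ₗ[ZMod 5] V n := LinearMap.fst (ZMod 5) (V n) (V n) ∘ₗ H'.subtype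
  -- A linear section of the projection of H, extended to the whole space; its second coordinate is
  -- T.
  obtain ⟨g₀, hg₀⟩ := p.rangeRestrict.exists_rightInverse_of_surjective p.range_rangeRestrict
  obtain ⟨g, hg⟩ := LinearMap.exists_extend g₀
  let T : V n →ₗ[ZMod 5] V n := LinearMap.snd (ZMod 5) (V n) (V n) ∘ₗ H'.subtype ∘ₗ g
  have hT : ∀ h ξ, (h, ξ) ∈ H → (h, T h) ∈ H := by
    intro h ξ hξ
    have hr : h ∈ LinearMap.range p := ⟨⟨(h, ξ), hξ⟩, rfl⟩
    have h1 : g h = g₀ ⟨h, hr⟩ := DFunLike.congr_fun hg ⟨h, hr⟩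
    have h2 : p (g h) = h := by
      rw [h1]
      exact congrArg Subtype.val (DFunLike.congr_fun hg₀ ⟨h, hr⟩)
    have h3 : ((g h : H') : V n × V n) = (h, T h) := Prod.ext h2 rfl
    rw [← h3]
    exact (g h).2
  let K : Finset (V n) := {k | ((0 : V n), k) ∈ H}
  let W : Finset (V n) := {h | (h, T h) ∈ H}
  have hW : η * cardV n ≤ #W := by
    refine hsum.trans ?_
    calc ∑ h : H, amb f h = ∑ v with v ∈ H, amb f v :=
          (sum_subtype _ (fun v => by simp) _).symm
      _ ≤ ∑ v ∈ W ×ˢ univ, amb f v := by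
          refine sum_le_sum_of_subset_of_nonneg ?_ fun _ _ _ => amb_nonneg f _
          rintro ⟨h, ξ⟩ hv
          simp only [W, mem_product, mem_filter, mem_univ, true_and, and_true] at hv ⊢
          exact hT h ξ hv
      _ = ∑ h ∈ W, ∑ ξ, amb f (h, ξ) := sum_product _ _ _
      _ ≤ ∑ h ∈ W, 1 := sum_le_sum fun h _ => sum_amb_fiber hf h
      _ = #W := by simp
  have hKW : #K * #W ≤ Fintype.card H := by
    rw [← card_product, ← card_univ]
    refine card_le_card_of_surjOn (fun v : H => (v.1.2 - T v.1.1, v.1.1)) ?_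
    rintro ⟨k, h⟩ hkh
    simp only [K, W, coe_product, Set.mem_prod, mem_coe, mem_filter, mem_univ, true_and] at hkh
    refine ⟨⟨(0, k) + (h, T h), H.add_mem hkh.1 hkh.2⟩, by simp, by simp⟩
  have hKsum : ∑ h : H, amb f h ≤ #K * ∑ h, amb f (h, T h) := by
    calc ∑ h : H, amb f h = ∑ v with v ∈ H, amb f v :=
          (sum_subtype _ (fun v => by simp) _).symm
      _ ≤ ∑ v ∈ (K ×ˢ (univ : Finset (V n))).image fun q => (0, q.1) + graphHom T q.2,
            amb f v := by
          refine sum_le_sum_of_subset_of_nonneg ?_ fun _ _ _ => amb_nonneg f _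
          rintro ⟨h, ξ⟩ hv
          have hv' : (h, ξ) ∈ H := by simpa using hv
          refine mem_image.2 ⟨(ξ - T h, h), ?_, by simp [graphHom_apply]⟩
          have := H.sub_mem hv' (hT h ξ hv')
          simpa [K] using this
      _ ≤ ∑ q ∈ K ×ˢ (univ : Finset (V n)), amb f ((0, q.1) + graphHom T q.2) :=
          sum_image_le_of_nonneg fun _ _ => amb_nonneg f _
      _ = ∑ k ∈ K, ∑ h, amb f ((0, k) + graphHom T h) := sum_product _ _ _
      _ ≤ ∑ k ∈ K, ∑ h, amb f (h, T h) :=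
          sum_le_sum fun k _ => sum_amb_coset_le f (graphHom T) (0, k)
      _ = #K * ∑ h, amb f (h, T h) := by rw [sum_const, nsmul_eq_mul]
  refine ⟨T, ?_⟩
  have hKW' : (#K : ℝ) * #W ≤ C * cardV n := le_trans (by exact_mod_cast hKW) hcard
  have hK : (#K : ℝ) * η ≤ C := by
    refine le_of_mul_le_mul_right (a := cardV n) ?_ hN
    refine le_trans ?_ hKW'
    rw [mul_assoc]
    gcongr
  have hX : 0 ≤ ∑ h, amb f (h, T h) := sum_nonneg fun _ _ => amb_nonneg f _
  rw [div_mul_eq_mul_div, div_le_iff₀ hC]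
  calc η ^ 2 * cardV n = η * (η * cardV n) := by ring
    _ ≤ η * (#K * ∑ h, amb f (h, T h)) := mul_le_mul_of_nonneg_left (hsum.trans hKsum) hη.le
    _ = (#K * η) * ∑ h, amb f (h, T h) := by ring
    _ ≤ C * ∑ h, amb f (h, T h) := by gcongr
    _ = _ := mul_comm _ _

/-- A bilinear exponential sum is bounded in terms of the kernel of the bilinear form. -/
theorem norm_bilinear_sum_sq_le {n : ℕ} {P Q : V n → ℂ} (hP : ∀ a, ‖P a‖ ≤ 1)
    (hQ : ∀ b, ‖Q b‖ ≤ 1) (L : V n →ₗ[ZMod 5] V n) [Fintype (LinearMap.ker L)] :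
    ‖∑ a, ∑ b, P a * Q b * ec (L a ⬝ᵥ b)‖ ^ 2 ≤
      cardV n ^ 3 * Fintype.card (LinearMap.ker L) := by
  classical
  have hN := cardV_pos n
  have h1 : ‖∑ a, ∑ b, P a * Q b * ec (L a ⬝ᵥ b)‖ ≤ ∑ b, ‖∑ a, P a * ec (L a ⬝ᵥ b)‖ := by
    rw [sum_comm]
    refine (norm_sum_le _ _).trans (sum_le_sum fun b _ => ?_)
    have : ∑ a, P a * Q b * ec (L a ⬝ᵥ b) = Q b * ∑ a, P a * ec (L a ⬝ᵥ b) := by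
      rw [mul_sum]
      exact sum_congr rfl fun a _ => by ring
    rw [this, norm_mul]
    exact mul_le_of_le_one_left (norm_nonneg _) (hQ b)
  have h2 : (∑ b, ‖∑ a, P a * ec (L a ⬝ᵥ b)‖) ^ 2 ≤
      cardV n * ∑ b, ‖∑ a, P a * ec (L a ⬝ᵥ b)‖ ^ 2 := by
    have := sq_sum_le_card_mul_sum_sq (s := (univ : Finset (V n)))
      (f := fun b => ‖∑ a, P a * ec (L a ⬝ᵥ b)‖)
    rwa [card_univ] at this
  have h3 : ((∑ b, ‖∑ a, P a * ec (L a ⬝ᵥ b)‖ ^ 2 : ℝ) : ℂ) =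
      ∑ a, ∑ a', P a * (starRingEnd ℂ) (P a') *
        (if L (a - a') = 0 then (cardV n : ℂ) else 0) := by
    have : ∀ b, (‖∑ a, P a * ec (L a ⬝ᵥ b)‖ : ℂ) ^ 2 =
        ∑ a, ∑ a', P a * (starRingEnd ℂ) (P a') * ec (b ⬝ᵥ L (a - a')) := by
      intro b
      rw [← Complex.mul_conj', map_sum, sum_mul_sum]
      refine sum_congr rfl fun a _ => sum_congr rfl fun a' _ => ?_
      rw [map_mul, conj_ec, map_sub, dotProduct_comm b, sub_dotProduct, sub_eq_add_neg,
        AddChar.map_add_eq_mul]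
      ring
    push_cast
    simp_rw [this]
    rw [sum_comm]
    refine sum_congr rfl fun a _ => ?_
    rw [sum_comm]
    simp_rw [← mul_sum, sum_ec_dotProduct]
  have h4 : ∑ b, ‖∑ a, P a * ec (L a ⬝ᵥ b)‖ ^ 2 ≤
      cardV n ^ 2 * Fintype.card (LinearMap.ker L) := by
    calc ∑ b, ‖∑ a, P a * ec (L a ⬝ᵥ b)‖ ^ 2
        ≤ ‖((∑ b, ‖∑ a, P a * ec (L a ⬝ᵥ b)‖ ^ 2 : ℝ) : ℂ)‖ := by
          rw [Complex.norm_real]; exact le_abs_self _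
      _ ≤ ∑ a : V n, ∑ a', (if L (a - a') = 0 then cardV n else 0) := by
          rw [h3]
          refine (norm_sum_le _ _).trans (sum_le_sum fun a _ => (norm_sum_le _ _).trans
            (sum_le_sum fun a' _ => ?_))
          rw [norm_mul, norm_mul, RCLike.norm_conj]
          have : ‖P a‖ * ‖P a'‖ ≤ 1 := mul_le_one₀ (hP a) (norm_nonneg _) (hP a')
          split_ifs
          · rw [Complex.norm_real, Real.norm_eq_abs, abs_of_pos hN]
            exact mul_le_of_le_one_left hN.le this
          · simp
      _ = ∑ a : V n, cardV n * Fintype.card (LinearMap.ker L) := by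
          refine sum_congr rfl fun a _ => ?_
          rw [← Equiv.sum_comp (Equiv.subLeft a)]
          simp only [Equiv.subLeft_apply, sub_sub_cancel]
          rw [← sum_filter, sum_const, nsmul_eq_mul, Fintype.card_subtype, mul_comm]
          simp [LinearMap.mem_ker]
      _ = _ := by
          rw [sum_const, nsmul_eq_mul, card_univ]
          simp only [cardV]
          ring
  calc ‖∑ a, ∑ b, P a * Q b * ec (L a ⬝ᵥ b)‖ ^ 2
      ≤ (∑ b, ‖∑ a, P a * ec (L a ⬝ᵥ b)‖) ^ 2 := by gcongr
    _ ≤ cardV n * (cardV n ^ 2 * Fintype.card (LinearMap.ker L)) := h2.trans (by gcongr)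
    _ = _ := by ring

theorem dotProduct_mulVec_transpose {n : ℕ} (M : Matrix (Fin n) (Fin n) (ZMod 5)) (a b : V n) :
    M.transpose.mulVec a ⬝ᵥ b = M.mulVec b ⬝ᵥ a := by
  rw [Matrix.mulVec_transpose, ← Matrix.dotProduct_mulVec, dotProduct_comm]

/-- If the ambiguity function is large on the graph of a matrix then the matrix is symmetric on a
large subspace. -/
theorem le_card_ker_of_le_sum_amb {n : ℕ} {f : V n → ℝ} (hf : ∀ x, |f x| ≤ 1)
    (M : Matrix (Fin n) (Fin n) (ZMod 5)) {η : ℝ} (hη : 0 < η)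
    (hsum : η * cardV n ≤ ∑ h, amb f (h, M.mulVec h))
    [Fintype (LinearMap.ker (M.transpose - M).mulVecLin)] :
    η ^ 2 * cardV n ≤ Fintype.card (LinearMap.ker (M.transpose - M).mulVecLin) := by
  have hN := cardV_pos n
  let L := (M.transpose - M).mulVecLin
  let P : V n → V n → ℂ := fun s a =>
    ((f a * f (s - a) : ℝ) : ℂ) * ec (M.mulVec a ⬝ᵥ s - M.mulVec a ⬝ᵥ a)
  let Q : V n → V n → ℂ := fun s b =>
    ((f b * f (s - b) : ℝ) : ℂ) * ec (M.mulVec b ⬝ᵥ b - M.mulVec b ⬝ᵥ s)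
  have hff : ∀ x y, ‖((f x * f y : ℝ) : ℂ)‖ ≤ 1 := fun x y => by
    rw [Complex.norm_real, Real.norm_eq_abs, abs_mul]
    exact mul_le_one₀ (hf x) (abs_nonneg _) (hf y)
  have hP : ∀ s a, ‖P s a‖ ≤ 1 := fun s a => by
    rw [norm_mul, norm_ec, mul_one]; exact hff _ _
  have hQ : ∀ s a, ‖Q s a‖ ≤ 1 := fun s a => by
    rw [norm_mul, norm_ec, mul_one]; exact hff _ _
  have key : ((cardV n ^ 2 * ∑ h, amb f (h, M.mulVec h) : ℝ) : ℂ) =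
      ∑ s, ∑ a, ∑ b, P s a * Q s b * ec (L a ⬝ᵥ b) := by
    have h1 : ((cardV n ^ 2 * ∑ h, amb f (h, M.mulVec h) : ℝ) : ℂ) =
        ∑ h, ∑ x, ∑ y, ((f x * f (x + h) : ℝ) : ℂ) * ((f y * f (y + h) : ℝ) : ℂ) *
          ec (M.mulVec h ⬝ᵥ x - M.mulVec h ⬝ᵥ y) := by
      rw [mul_sum, Complex.ofReal_sum]
      refine sum_congr rfl fun h _ => ?_
      rw [amb, mul_div_cancel₀ _ (by positivity), Complex.ofReal_pow, ← Complex.mul_conj',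
        map_sum, sum_mul_sum]
      refine sum_congr rfl fun x _ => sum_congr rfl fun y _ => ?_
      rw [map_mul, conj_ec, Complex.conj_ofReal, sub_eq_add_neg, AddChar.map_add_eq_mul]
      ring
    rw [h1, sum_comm]
    have h2 : ∑ s, ∑ a, ∑ b, P s a * Q s b * ec (L a ⬝ᵥ b) =
        ∑ a, ∑ b, ∑ s, P s a * Q s b * ec (L a ⬝ᵥ b) := by
      rw [sum_comm]
      exact sum_congr rfl fun a _ => sum_comm
    rw [h2]
    refine sum_congr rfl fun a _ => ?_
    rw [← Equiv.sum_comp (Equiv.subRight a)]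
    refine sum_congr rfl fun b _ => ?_
    -- The variables are a = x, b = x + h, s = x + y + h. For fixed s the summand is a function of a
    -- times one of b, apart from a bilinear phase that measures the asymmetry of M.
    rw [← Equiv.sum_comp (Equiv.subRight b)]
    refine sum_congr rfl fun s _ => ?_
    simp only [Equiv.subRight_apply, P, Q, L, Matrix.mulVecLin_apply]
    have e1 : a + (b - a) = b := by abel
    have e2 : s - b + (b - a) = s - a := by abel
    rw [e1, e2, Matrix.sub_mulVec, sub_dotProduct, dotProduct_mulVec_transpose]
    have e3 : M.mulVec (b - a) ⬝ᵥ a - M.mulVec (b - a) ⬝ᵥ (s - b) =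
        (M.mulVec a ⬝ᵥ s - M.mulVec a ⬝ᵥ a) + (M.mulVec b ⬝ᵥ b - M.mulVec b ⬝ᵥ s) +
          (M.mulVec b ⬝ᵥ a - M.mulVec a ⬝ᵥ b) := by
      simp only [Matrix.mulVec_sub, sub_dotProduct, dotProduct_sub]
      ring
    rw [e3, AddChar.map_add_eq_mul, AddChar.map_add_eq_mul]
    push_cast
    ring
  have hX : 0 ≤ ∑ h, amb f (h, M.mulVec h) := sum_nonneg fun _ _ => amb_nonneg f _
  have h1 : cardV n ^ 2 * ∑ h, amb f (h, M.mulVec h) ≤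
      ∑ s, ‖∑ a, ∑ b, P s a * Q s b * ec (L a ⬝ᵥ b)‖ := by
    calc _ ≤ ‖((cardV n ^ 2 * ∑ h, amb f (h, M.mulVec h) : ℝ) : ℂ)‖ := by
          rw [Complex.norm_real]; exact le_abs_self _
      _ ≤ _ := by rw [key]; exact norm_sum_le _ _
  have h2 : (∑ s, ‖∑ a, ∑ b, P s a * Q s b * ec (L a ⬝ᵥ b)‖) ^ 2 ≤
      cardV n * ∑ s, ‖∑ a, ∑ b, P s a * Q s b * ec (L a ⬝ᵥ b)‖ ^ 2 := by
    have := sq_sum_le_card_mul_sum_sq (s := (univ : Finset (V n)))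
      (f := fun s => ‖∑ a, ∑ b, P s a * Q s b * ec (L a ⬝ᵥ b)‖)
    rwa [card_univ] at this
  have h3 : ∑ s, ‖∑ a, ∑ b, P s a * Q s b * ec (L a ⬝ᵥ b)‖ ^ 2 ≤
      cardV n * (cardV n ^ 3 * Fintype.card (LinearMap.ker L)) := by
    refine (sum_le_sum fun s _ => norm_bilinear_sum_sq_le (hP s) (hQ s) L).trans (le_of_eq ?_)
    rw [sum_const, nsmul_eq_mul, card_univ]
    rfl
  have h4 : (cardV n ^ 2 * (η * cardV n)) ^ 2 ≤
      cardV n * (cardV n * (cardV n ^ 3 * Fintype.card (LinearMap.ker L))) := by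
    calc _ ≤ (cardV n ^ 2 * ∑ h, amb f (h, M.mulVec h)) ^ 2 := by gcongr
      _ ≤ _ := by gcongr
      _ ≤ _ := h2
      _ ≤ _ := by gcongr
  refine le_of_mul_le_mul_left (a := cardV n ^ 5) ?_ (by positivity)
  calc cardV n ^ 5 * (η ^ 2 * cardV n) = (cardV n ^ 2 * (η * cardV n)) ^ 2 := by ring
    _ ≤ _ := h4
    _ = _ := by ring

/-- On W = ker(Mᵀ − M) the matrix M agrees with its symmetrisation (M + Mᵀ)/2. Averaging over the
cosets of the graph above W loses only the density η² of W. -/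
theorem exists_isSymm_of_le_sum_amb {n : ℕ} {f : V n → ℝ} (hf : ∀ x, |f x| ≤ 1)
    (M : Matrix (Fin n) (Fin n) (ZMod 5)) {η : ℝ} (hη : 0 < η)
    (hsum : η * cardV n ≤ ∑ h, amb f (h, M.mulVec h)) :
    ∃ M' : Matrix (Fin n) (Fin n) (ZMod 5), M'.IsSymm ∧
      η ^ 3 * cardV n ≤ ∑ h, amb f (h, M'.mulVec h) := by
  classical
  have hN := cardV_pos n
  let W := LinearMap.ker (M.transpose - M).mulVecLin
  have hW : η ^ 2 * cardV n ≤ Fintype.card W := le_card_ker_of_le_sum_amb hf M hη hsum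
  let φ : W →+ V n × V n := (graphHom M.mulVecLin).comp W.subtype.toAddMonoidHom
  have hφ : ∀ w : W, φ w = (w.1, M.mulVec w.1) := fun w => rfl
  have havg : Fintype.card W * ∑ h, amb f (h, M.mulVec h) ≤ cardV n * ∑ w, amb f (φ w) := by
    calc Fintype.card W * ∑ h, amb f (h, M.mulVec h)
        = ∑ w : W, ∑ h, amb f ((h, M.mulVec h) + φ w) := by
          rw [← nsmul_eq_mul, ← card_univ, ← sum_const]
          refine sum_congr rfl fun w _ => ?_
          rw [← Equiv.sum_comp (Equiv.addRight w.1)]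
          refine sum_congr rfl fun h _ => ?_
          simp [hφ, Matrix.mulVec_add]
      _ = ∑ h, ∑ w : W, amb f ((h, M.mulVec h) + φ w) := sum_comm
      _ ≤ ∑ h : V n, ∑ w : W, amb f (φ w) :=
          sum_le_sum fun h _ => sum_amb_coset_le f φ (h, M.mulVec h)
      _ = _ := by rw [sum_const, nsmul_eq_mul, card_univ]; rfl
  refine ⟨(3 : ZMod 5) • (M + M.transpose), ?_, ?_⟩
  · refine Matrix.IsSymm.smul ?_ _
    rw [Matrix.IsSymm, Matrix.transpose_add, Matrix.transpose_transpose, add_comm]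
  · have h1 : ∀ w : W, φ w = (w.1, ((3 : ZMod 5) • (M + M.transpose)).mulVec w.1) := by
      intro w
      have hw : (M.transpose - M).mulVec w.1 = 0 := w.2
      rw [Matrix.sub_mulVec, sub_eq_zero] at hw
      rw [hφ, Matrix.smul_mulVec, Matrix.add_mulVec, hw, ← two_smul (ZMod 5), smul_smul]
      have : (3 * 2 : ZMod 5) = 1 := by decide
      rw [this, one_smul]
    have h2 : ∑ w, amb f (φ w) ≤
        ∑ h, amb f (h, ((3 : ZMod 5) • (M + M.transpose)).mulVec h) := by
      simp_rw [h1]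
      rw [← sum_subtype (univ.filter (· ∈ W)) (fun v => by simp)
        (fun h => amb f (h, ((3 : ZMod 5) • (M + M.transpose)).mulVec h))]
      exact sum_le_sum_of_subset_of_nonneg (subset_univ _) fun _ _ _ => amb_nonneg f _
    refine le_trans ?_ h2
    refine le_of_mul_le_mul_left (a := cardV n) ?_ hN
    calc cardV n * (η ^ 3 * cardV n) = (η ^ 2 * cardV n) * (η * cardV n) := by ring
      _ ≤ Fintype.card W * ∑ h, amb f (h, M.mulVec h) := by gcongr
      _ ≤ _ := havg

/-- As 2 · 3 = 1 in 𝔽₅, differencing the phase of 3M in direction h produces the frequency M h, up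
to a constant phase and conjugation. -/
theorem amb_eq_of_isSymm {n : ℕ} (f : V n → ℝ) {M : Matrix (Fin n) (Fin n) (ZMod 5)}
    (hM : M.IsSymm) (h : V n) :
    ‖∑ x, ((f x : ℂ) * quadPhase ((3 : ZMod 5) • M) 0 x) *
      (starRingEnd ℂ) ((f (x + h) : ℂ) * quadPhase ((3 : ZMod 5) • M) 0 (x + h))‖ ^ 2 =
      cardV n ^ 2 * amb f (h, M.mulVec h) := by
  have hN := cardV_pos n
  have h1 : ∀ x, ((f x : ℂ) * quadPhase ((3 : ZMod 5) • M) 0 x) *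
      (starRingEnd ℂ) ((f (x + h) : ℂ) * quadPhase ((3 : ZMod 5) • M) 0 (x + h)) =
      ec (-(3 * (h ⬝ᵥ M.mulVec h))) *
        (starRingEnd ℂ) (((f x * f (x + h) : ℝ) : ℂ) * ec (M.mulVec h ⬝ᵥ x)) := by
    intro x
    simp only [map_mul, quadPhase, zero_dotProduct, add_zero, Complex.conj_ofReal]
    have e1 : x ⬝ᵥ M.mulVec h = M.mulVec h ⬝ᵥ x := dotProduct_comm _ _
    have e2 : h ⬝ᵥ M.mulVec x = M.mulVec h ⬝ᵥ x := by
      rw [dotProduct_comm, ← dotProduct_mulVec_transpose, hM.eq]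
    have e3 : x ⬝ᵥ ((3 : ZMod 5) • M).mulVec x +
        -((x + h) ⬝ᵥ ((3 : ZMod 5) • M).mulVec (x + h)) =
        -(3 * (h ⬝ᵥ M.mulVec h)) + -(M.mulVec h ⬝ᵥ x) := by
      simp only [Matrix.smul_mulVec, Matrix.mulVec_add, dotProduct_smul, add_dotProduct,
        dotProduct_add, smul_eq_mul, e1, e2]
      have : (5 : ZMod 5) = 0 := by decide
      linear_combination (-(M.mulVec h ⬝ᵥ x)) * this
    have e4 := congrArg ec e3
    rw [AddChar.map_add_eq_mul, AddChar.map_add_eq_mul] at e4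
    simp only [conj_ec]
    push_cast
    linear_combination ((f x : ℂ) * f (x + h)) * e4
  simp_rw [h1]
  rw [← mul_sum, norm_mul, norm_ec, one_mul, ← map_sum, RCLike.norm_conj, amb]
  field_simp

theorem exists_quadPhase_correlation {n : ℕ} {f : V n → ℝ} (hf : ∀ x, |f x| ≤ 1)
    {M : Matrix (Fin n) (Fin n) (ZMod 5)} (hM : M.IsSymm) {η : ℝ} (hη : 0 < η)
    (hsum : η * cardV n ≤ ∑ h, amb f (h, M.mulVec h)) :
    ∃ r : V n, Real.sqrt (η / 2) * cardV n ≤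
      ‖∑ x, (f x : ℂ) * quadPhase ((3 : ZMod 5) • M) r x‖ := by
  have hN := cardV_pos n
  let g : V n → ℂ := fun x => (f x : ℂ) * quadPhase ((3 : ZMod 5) • M) 0 x
  have hg : ∀ x, ‖g x‖ ≤ 1 := fun x => by
    rw [norm_mul, norm_quadPhase, mul_one, Complex.norm_real]
    exact hf x
  let a : V n → ℝ := fun η => ‖∑ x, g x * ec (η ⬝ᵥ x)‖ ^ 2
  have hc : ∀ y, (cardV n : ℂ) * ∑ x, g x * (starRingEnd ℂ) (g (x + y)) =
      ∑ η, (a η : ℂ) * ec (η ⬝ᵥ y) := fun y => (sum_norm_sq_fourier g y).symm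
  have h1 := parseval hc
  have h2 : ∀ y, ‖(cardV n : ℂ) * ∑ x, g x * (starRingEnd ℂ) (g (x + y))‖ ^ 2 =
      cardV n ^ 4 * amb f (y, M.mulVec y) := by
    intro y
    rw [norm_mul, mul_pow, amb_eq_of_isSymm f hM, Complex.norm_real, Real.norm_eq_abs, sq_abs]
    ring
  simp_rw [h2, Complex.norm_real, Real.norm_eq_abs, sq_abs] at h1
  rw [← mul_sum] at h1
  have h3 : ∑ ξ, a ξ ≤ cardV n ^ 2 := by
    have h4 := hc 0
    simp only [add_zero, dotProduct_zero, AddChar.map_zero_eq_one, mul_one] at h4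
    calc ∑ ξ, a ξ ≤ ‖((∑ ξ, a ξ : ℝ) : ℂ)‖ := by
          rw [Complex.norm_real]; exact le_abs_self _
      _ = cardV n * ‖∑ x, g x * (starRingEnd ℂ) (g x)‖ := by
          rw [Complex.ofReal_sum, ← h4, norm_mul, Complex.norm_real, Real.norm_eq_abs,
            abs_of_pos hN]
      _ ≤ cardV n * ∑ x : V n, 1 := by
          refine mul_le_mul_of_nonneg_left ((norm_sum_le _ _).trans (sum_le_sum fun x _ => ?_))
            hN.le
          rw [norm_mul, RCLike.norm_conj]
          exact mul_le_one₀ (hg x) (norm_nonneg _) (hg x)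
      _ = cardV n ^ 2 := by simp [cardV, sq]
  -- The maximum of a is at least Σ a² / Σ a; the factor 1/2 only leaves room for a strict
  -- contradiction.
  have h5 : ∃ ξ, η / 2 * cardV n ^ 2 ≤ a ξ := by
    by_contra! hcon
    have h6 : ∑ ξ, a ξ ^ 2 ≤ η / 2 * cardV n ^ 2 * cardV n ^ 2 := by
      calc ∑ ξ, a ξ ^ 2 ≤ ∑ ξ, η / 2 * cardV n ^ 2 * a ξ := by
            refine sum_le_sum fun ξ _ => ?_
            rw [sq]
            exact mul_le_mul_of_nonneg_right (hcon ξ).le (sq_nonneg _)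
        _ ≤ _ := by rw [← mul_sum]; gcongr
    have h7 : cardV n ^ 4 * (η * cardV n) ≤ cardV n * (η / 2 * cardV n ^ 2 * cardV n ^ 2) :=
      calc _ ≤ cardV n ^ 4 * ∑ h, amb f (h, M.mulVec h) := by gcongr
        _ = _ := h1
        _ ≤ _ := by gcongr
    have h8 : 0 < η * cardV n ^ 5 := by positivity
    nlinarith
  obtain ⟨ξ, hξ⟩ := h5
  refine ⟨ξ, ?_⟩
  have h6 : ∑ x, (f x : ℂ) * quadPhase ((3 : ZMod 5) • M) ξ x = ∑ x, g x * ec (ξ ⬝ᵥ x) := by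
    refine sum_congr rfl fun x _ => ?_
    simp only [g, quadPhase, zero_dotProduct, add_zero, AddChar.map_add_eq_mul]
    ring
  rw [h6]
  refine le_of_sq_le_sq ?_ (norm_nonneg _)
  rw [mul_pow, Real.sq_sqrt (by positivity)]
  exact hξ

theorem u3Norm_eq {n : ℕ} (f : V n → ℝ) : u3Norm f = u3Pow f ^ (1 / 8 : ℝ) := rfl

theorem u3Pow_nonneg {n : ℕ} (f : V n → ℝ) : 0 ≤ u3Pow f := by
  rw [u3Pow_eq]
  exact div_nonneg (sum_nonneg fun _ _ => sq_nonneg _) (cardV_pos n).le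

theorem u3Pow_smul {n : ℕ} (c : ℝ) (f : V n → ℝ) : u3Pow (fun x => c * f x) = c ^ 8 * u3Pow f := by
  simp only [u3Pow, mul_expect]
  refine expect_congr rfl fun x _ => expect_congr rfl fun h₁ _ => expect_congr rfl fun h₂ _ =>
    expect_congr rfl fun h₃ _ => ?_
  ring

/-- The inverse theorem for the `U³` norm on `𝔽₅ⁿ`. -/
theorem inverseU3 : InverseU3 := by
  intro ε hε
  obtain ⟨η, hη, C, hC, H⟩ := exists_addSubgroup_of_u3Pow (ε := (1 / 2) ^ 8 * ε ^ 8)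
    (by positivity)
  -- Passing to a graph gives η²/C, symmetrising cubes it, and the Fourier coefficient costs the
  -- half and the square root. Halving g makes it 1-bounded and accounts for the factor (1/2)⁸.
  refine ⟨Real.sqrt ((η ^ 2 / C) ^ 3 / 2), by positivity, fun n g hg hu => ?_⟩
  let f : V n → ℝ := fun x => 1 / 2 * g x
  have hf : ∀ x, |f x| ≤ 1 := fun x => by
    have := hg x
    simp only [f, abs_mul]
    norm_num
    linarith
  have hpow : (1 / 2) ^ 8 * ε ^ 8 ≤ u3Pow f := by
    rw [u3Pow_smul]
    refine mul_le_mul_of_nonneg_left ?_ (by positivity)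
    rw [u3Norm_eq] at hu
    calc ε ^ 8 ≤ (u3Pow g ^ (1 / 8 : ℝ)) ^ 8 := by gcongr
      _ = u3Pow g := by
        rw [← Real.rpow_natCast, ← Real.rpow_mul (u3Pow_nonneg g)]
        norm_num
  obtain ⟨H, _, hcard, hsum⟩ := H n f hf hpow
  obtain ⟨T, hT⟩ := exists_linearMap_of_addSubgroup hf H hη hC hcard hsum
  obtain ⟨M, hM, hMsum⟩ := exists_isSymm_of_le_sum_amb hf (LinearMap.toMatrix' T)
    (η := η ^ 2 / C) (by positivity) (by simpa only [LinearMap.toMatrix'_mulVec] using hT)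
  obtain ⟨r, hr⟩ := exists_quadPhase_correlation hf hM (by positivity) hMsum
  refine ⟨(3 : ZMod 5) • M, r, hM.smul _, hr.trans ?_⟩
  have h1 : ∑ x, (f x : ℂ) * quadPhase ((3 : ZMod 5) • M) r x =
      ((1 / 2 : ℝ) : ℂ) * ∑ x, (g x : ℂ) * quadPhase ((3 : ZMod 5) • M) r x := by
    rw [mul_sum]
    refine sum_congr rfl fun x _ => ?_
    simp only [f]
    push_cast
    ring
  rw [h1, norm_mul, Complex.norm_real]
  refine mul_le_of_le_one_left (norm_nonneg _) ?_
  norm_num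

end QuadFourier

end

theorem mainTheorem4 (δ : ℝ) (hδ : 0 < δ) (ω : ℝ → ℝ) (hω : ∀ t, 0 ≤ t → 0 < ω t)
    (d₁ d₂ : ℕ) :
    ∃ C : ℕ, ∀ (n : ℕ) (f : QuadFourier.V n → ℝ), (∀ x, f x ∈ Set.Icc (-1 : ℝ) 1) →
      ∀ A₁ A₂ : MeasurableSpace (QuadFourier.V n),
        QuadFourier.IsQuadraticFactor A₁ A₂ d₁ d₂ →
        ∃ d ≤ C, ∃ B₁ B₂ : MeasurableSpace (QuadFourier.V n),
          QuadFourier.IsQuadraticFactorAtMost B₁ B₂ d d ∧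
          QuadFourier.Refines B₁ A₁ ∧ QuadFourier.Refines B₂ A₂ ∧
          ∃ f₁ f₂ f₃ : QuadFourier.V n → ℝ,
            f = f₁ + f₂ + f₃ ∧
            f₁ = QuadFourier.condExpect f B₂ ∧
            QuadFourier.l2Norm f₂ ≤ δ ∧
            QuadFourier.u3Norm f₃ ≤ 1 / ω d :=
  QuadFourier.arithmetic_regularity QuadFourier.inverseU3 δ hδ ω hω d₁ d₂
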